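/- **Setting.** Let $K\ge 2$ and $1\le T<L$ be integers, and let $\rho\in(0,1)$, $c>0$, $\kappa>0$, $\eta_0>0$ be constants. For a matrix $A\in\mathbb R^{n\times n}$ put $D_A=\mathrm{diag}(A\mathbf 1)$, and let $\|A\|$ be its spectral norm. Let $V=\{1,\dots,n\}$ be partitioned into communities $V_1,\dots,V_K$ of equal size $n/K$, let $0<q<p\le 1$, and let $G$ be a graph on $V$ drawn from the symmetric stochastic block model: edges are independent, with probability $p$ inside a community and $q$ across communities. Let $\bar A$ be the matrix with $\bar A_{ij}=p$ if $i,j$ lie in the same community and $\bar A_{ij}=q$ otherwise, $\bar d=\frac nK p+\frac{n(K-1)}{K}q$, $\bar P=D_{\bar A}^{-1}\bar A$, and $$\bar C=2\sum_{t=1}^T\frac{L-t}{n\bar d}\,D_{\bar A}\bar P^{\,t}.$$ Let $C$ be a co-occurrence matrix of $G$ for walks with $L$ vertices and window size $T$: either the limit $C_{ij}=2\sum_{t=1}^T(L-t)\,\pi_i\,(P^t)_{ij}$ with $P=D_A^{-1}A$ and $\pi_i=\frac{d_i}{2|E|}$, where $A$ is the adjacency matrix, $d_i$ the degrees and $|E|$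 the number of edges of $G$; or, for some realization $w^{(1)},\dots,w^{(r)}$ of $r\ge1$ walks in $G$, the normalized count $$C_{ij}=\frac1r\sum_{t=1}^T\sum_{m=1}^r\sum_{k=1}^{L-t}\left(\mathbb 1\{w^{(m)}_k=i,\,w^{(m)}_{k+t}=j\}+\mathbb 1\{w^{(m)}_k=j,\,w^{(m)}_{k+t}=i\}\right).$$ **Algorithm.** Let $\eta>0$, $\epsilon=n^{-2/3}$ and $\Delta=n^{1/6}$. Draw $g\in\mathbb R^{2n}$ with independent $\mathcal N(0,1)$ coordinates and put $w^{(0)}=\epsilon\, g/\|g\|$. Writing $w=(x,y)$ with $x,y\in\mathbb R^n$, iterate $$w^{(t+1)}=\begin{bmatrix} I&-\eta G^{(t)}\\-\eta (G^{(t)})^{\top}&I\end{bmatrix}w^{(t)},\qquad G^{(t)}=D_CQ^{(t)}-C,\qquad Q^{(t)}_{ij}=\frac{\exp\big(x^{(t)}_iy^{(t)}_j\big)}{\sum_{k}\exp\big(x^{(t)}_iy^{(t)}_k\big)},$$ stop at the first $t_f\ge1$ with $\|w^{(t_f)}\|\ge\epsilon\Delta$, and return $w^{(t_f)}=(x,y)$.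 Let $\mu_{V_i}=\frac1{|V_i|}\sum_{r\in V_i}x_r$. **Theorem.** There is $N$, depending only on $K,L,T,\rho,c,\kappa,\eta_0$, such that the following holds for all $n\ge N$ divisible by $K$, all communities as above, all $0<q<p\le1$ with $p-q\ge\kappa p$, and all $0<\eta\le\eta_0$. For every realization of $G$ and every co-occurrence matrix $C$ of $G$ such that $R=C-\bar C$ is symmetric with $\|R\|<\frac{c}{\sqrt{n^{\rho+2}}}$, with probability at least $0.9$ over the initialization $g$ the algorithm terminates and $$|\mu_{V_i}-\mu_{V_j}|\ \ge\ \frac{\epsilon\Delta}{20K^2\sqrt n}\qquad\text{for all } i\ne j.$$ -/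

import Mathlib

noncomputable section

namespace DeepWalk

open MeasureTheory ProbabilityTheory

/-! ### Matrices, graphs and the stochastic block model -/

/-- The degree operator `D(A) = diag(A 𝟏)`. -/
def degMat {n : ℕ} (A : Matrix (Fin n) (Fin n) ℝ) : Matrix (Fin n) (Fin n) ℝ :=
  Matrix.diagonal fun i => ∑ j, A i j

/-- The transition matrix `D(A)⁻¹ A`, row by row: row `i` of `A` is divided by the degree of `i`
(a vertex of degree zero gets a zero row). -/
def transMat {n : ℕ} (A : Matrix (Fin n) (Fin n) ℝ) : Matrix (Fin n) (Fin n) ℝ :=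
  Matrix.of fun i j => A i j / ∑ k, A i k

/-- The spectral norm `max_{‖x‖ = 1} ‖A x‖` for the Euclidean norm. -/
def specNorm {n : ℕ} (A : Matrix (Fin n) (Fin n) ℝ) : ℝ :=
  ‖Matrix.toEuclideanCLM (n := Fin n) (𝕜 := ℝ) A‖

/-- The assignment `σ` of vertices to communities splits the vertex set into `K` communities of
equal size `n / K`. -/
def Balanced {n K : ℕ} (σ : Fin n → Fin K) : Prop :=
  ∀ k, K * (Finset.univ.filter fun i => σ i = k).card = n

/-- The matrix of edge probabilities: `p` inside the communities, `q` across. It is the expected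
adjacency matrix. -/
def expAdj {n K : ℕ} (σ : Fin n → Fin K) (p q : ℝ) : Matrix (Fin n) (Fin n) ℝ :=
  Matrix.of fun i j => if σ i = σ j then p else q

/-- The random graph `G` is drawn from the symmetric stochastic block model with communities `σ`:
the edges are independent, `{i, j}` being present with probability `p` if `i` and `j` are in the
same community and `q` otherwise. -/
structure IsSBM {Ω : Type*} [MeasurableSpace Ω] {n K : ℕ} (σ : Fin n → Fin K) (p q : ℝ)
    (μ : Measure Ω) (G : Ω → SimpleGraph (Fin n)) : Prop where
  measurableSet_adj : ∀ i j, MeasurableSet {ω | (G ω).Adj i j}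
  indep : iIndepSet
    (fun e : {e : Fin n × Fin n // e.1 < e.2} => {ω | (G ω).Adj e.1.1 e.1.2}) μ
  prob_adj : ∀ i j, i < j → μ {ω | (G ω).Adj i j} = ENNReal.ofReal (expAdj σ p q i j)

/-! ### Co-occurrence matrices -/

open Classical in
/-- The adjacency matrix. -/
def adj {n : ℕ} (G : SimpleGraph (Fin n)) : Matrix (Fin n) (Fin n) ℝ :=
  G.adjMatrix ℝ

/-- The stationary distribution `π_i = d_i / (2 |E|)`. -/
def statDist {n : ℕ} (G : SimpleGraph (Fin n)) (i : Fin n) : ℝ :=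
  (∑ j, adj G i j) / (2 * (G.edgeSet.ncard : ℝ))

/-- The limiting co-occurrence matrix of the graph (walk length `L`, window size `T`):
`C_ij = 2 ∑_{t=1}^T (L - t) π_i (P^t)_ij`. -/
def limitCooc {n : ℕ} (G : SimpleGraph (Fin n)) (L T : ℕ) : Matrix (Fin n) (Fin n) ℝ :=
  Matrix.of fun i j =>
    2 * ∑ t ∈ Finset.Icc 1 T, ((L : ℝ) - t) * (statDist G i * (transMat (adj G) ^ t) i j)

/-- The number of times that, in the `r` walks `w`, the vertex `j` is visited exactly `t` steps
after the vertex `i`, for some `1 ≤ t ≤ T`. The walk number `m` is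
`w m 0, …, w m (L - 1)`; later values of `w m` are not used. -/
def windowCount {n r : ℕ} (w : Fin r → ℕ → Fin n) (L T : ℕ) (i j : Fin n) : ℝ :=
  ∑ t ∈ Finset.Icc 1 T, ∑ m : Fin r, ∑ k ∈ Finset.range (L - t),
    if w m k = i ∧ w m (k + t) = j then 1 else 0

/-- The co-occurrence matrix of `r` walks, normalized by the number of walks. -/
def empiricalCooc {n r : ℕ} (w : Fin r → ℕ → Fin n) (L T : ℕ) : Matrix (Fin n) (Fin n) ℝ :=
  Matrix.of fun i j => (windowCount w L T i j + windowCount w L T j i) / r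

/-- `C` is a co-occurrence matrix of the graph `G`: either the normalized matrix of some
realization of finitely many walks with `L` vertices in `G`, or the limiting matrix, as the number
of walks tends to infinity. -/
def IsCooccurrence {n : ℕ} (G : SimpleGraph (Fin n)) (L T : ℕ)
    (C : Matrix (Fin n) (Fin n) ℝ) : Prop :=
  C = limitCooc G L T ∨
    ∃ (r : ℕ) (w : Fin r → ℕ → Fin n), 0 < r ∧
      (∀ m k, k + 1 < L → G.Adj (w m k) (w m (k + 1))) ∧ C = empiricalCooc w L T

/-- The expected degree `(n / K) p + (n (K - 1) / K) q`. -/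
def expDeg (n K : ℕ) (p q : ℝ) : ℝ :=
  (n : ℝ) / K * p + (n : ℝ) * ((K : ℝ) - 1) / K * q

/-- The expected co-occurrence matrix
`2 ∑_{t=1}^T (L - t) / (n d) • D(A) P^t`, where `A` is the expected adjacency matrix, `d` the
expected degree and `P = D(A)⁻¹ A`. -/
def expCooc {n K : ℕ} (σ : Fin n → Fin K) (p q : ℝ) (L T : ℕ) : Matrix (Fin n) (Fin n) ℝ :=
  (2 : ℝ) • ∑ t ∈ Finset.Icc 1 T, (((L : ℝ) - t) / ((n : ℝ) * expDeg n K p q)) •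
    (degMat (expAdj σ p q) * transMat (expAdj σ p q) ^ t)

/-- The co-occurrence matrix `C` of the graph `G` is `R + (expected co-occurrence matrix)` with `R`
symmetric and `‖R‖ < c / √(n^(ρ+2))` in spectral norm. -/
structure CoocAssumption {n K : ℕ} (σ : Fin n → Fin K) (p q : ℝ) (L T : ℕ) (ρ c : ℝ)
    (G : SimpleGraph (Fin n)) (C : Matrix (Fin n) (Fin n) ℝ) : Prop where
  isCooccurrence : IsCooccurrence G L T C
  symm : (C - expCooc σ p q L T).IsSymm
  norm_lt : specNorm (C - expCooc σ p q L T) < c / Real.sqrt ((n : ℝ) ^ (ρ + 2))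

/-! ### The gradient descent algorithm, for one-dimensional embeddings -/

/-- A pair of embeddings: `w (Sum.inl i)` is the node embedding `x_i` and `w (Sum.inr i)` the
context embedding `y_i`. The norm is the Euclidean norm of `ℝ^(2n)`. -/
abbrev Emb (n : ℕ) : Type := EuclideanSpace ℝ (Fin n ⊕ Fin n)

/-- The softmax matrix `Q_ij = exp (x_i y_j) / ∑_k exp (x_i y_k)`. -/
def softmax {n : ℕ} (w : Emb n) : Matrix (Fin n) (Fin n) ℝ :=
  Matrix.of fun i j => Real.exp (w (Sum.inl i) * w (Sum.inr j)) /
    ∑ k, Real.exp (w (Sum.inl i) * w (Sum.inr k))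

/-- The matrix `D(C) Q - C`. -/
def gradMat {n : ℕ} (C : Matrix (Fin n) (Fin n) ℝ) (w : Emb n) : Matrix (Fin n) (Fin n) ℝ :=
  degMat C * softmax w - C

/-- One update, `w ↦ [[I, -η G], [-η Gᵀ, I]] w` with `G = D(C) Q - C`. -/
def step {n : ℕ} (C : Matrix (Fin n) (Fin n) ℝ) (η : ℝ) (w : Emb n) : Emb n :=
  WithLp.toLp 2 ((Matrix.fromBlocks 1 (-(η • gradMat C w)) (-(η • (gradMat C w).transpose)) 1).mulVec
    (WithLp.ofLp w))

/-- The radius `ε = 1 / n^(2/3)` of the initialization. -/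
def eps (n : ℕ) : ℝ := 1 / (n : ℝ) ^ ((2 : ℝ) / 3)

/-- The parameter `Δ = n^(1/6)`. -/
def Del (n : ℕ) : ℝ := (n : ℝ) ^ ((1 : ℝ) / 6)

/-- The iterate after `t` updates, from the sample `g` normalized to have norm `ε`. -/
def iter {n : ℕ} (C : Matrix (Fin n) (Fin n) ℝ) (η : ℝ) (g : Emb n) (t : ℕ) : Emb n :=
  (step C η)^[t] ((eps n / ‖g‖) • g)

/-- The algorithm, started from the sample `g`, terminates and returns `w`, the iterate after the
first number `t ≥ 1` of updates for which the norm is at least `ε Δ`. -/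
def Returns {n : ℕ} (C : Matrix (Fin n) (Fin n) ℝ) (η : ℝ) (g : Emb n) (w : Emb n) : Prop :=
  ∃ t : ℕ, 1 ≤ t ∧ eps n * Del n ≤ ‖iter C η g t‖ ∧
    (∀ s, 1 ≤ s → s < t → ‖iter C η g s‖ < eps n * Del n) ∧ w = iter C η g t

/-- The law of the sample: `2n` independent standard Gaussian coordinates. -/
def initLaw (n : ℕ) : Measure (Emb n) :=
  (Measure.pi fun _ : Fin n ⊕ Fin n => gaussianReal 0 1).map (WithLp.toLp 2)

/-- The mean of the node embedding over the community `k`. -/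
def clusterMean {n K : ℕ} (σ : Fin n → Fin K) (w : Emb n) (k : Fin K) : ℝ :=
  (∑ r ∈ Finset.univ.filter (fun r => σ r = k), w (Sum.inl r)) /
    ((Finset.univ.filter fun r => σ r = k).card : ℝ)

end DeepWalk

end

noncomputable section

namespace DeepWalk

open scoped RealInnerProductSpace
open MeasureTheory ProbabilityTheory

/-! ### Spectral projections of perturbed symmetric tripotents -/

section Spectral

variable {E : Type*} [NormedAddCommGroup E] [InnerProductSpace ℝ E]

/-! While the iterate is small, softmax is nearly uniform and gradient descent is nearly power
iteration. Replacing `softmax w` by `avgMat n` turns the negative gradient into `C * (1 - avgMat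
n)`. The expected part of this matrix is `h • blockProj σ` with `h` of order `1/n`, and the random
part has norm at most `f`, of order `n^(-1-ρ/2)`. The off-diagonal block operator `S` of `blockProj
σ` satisfies `S³ = S`. An update is therefore `w ↦ w + η (h S w + F w + r)` with `‖F‖ ≤ f ≪ h` and
`r` cubic in `w` (`neg_gradMat_eq`, `norm_remainder_le`).

The eigenvalues of `h S + F` above `h/2` lie within `16 f` of `h`, and the others are at most `16
f`. Let `P` project onto the eigenvectors of the first kind (`exists_isTopProjection`). Under the
iteration `P w` grows like `(1 + η h)^t` with almost constant direction, while `w - P w` stays below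
`2ε` (`IsTopProjection.exists_exit`). The time scale `η t ≈ n^(1+ρ/4)` lies between `1/h` and `1/f`:
it is long enough for the signal to reach radius `εΔ = n^(-1/2)`, and too short for `F` and `r` to
matter (`exists_horizon`). Since `Δ` is large, the output is close to a multiple of `P g` of norm
about `εΔ`.

It remains to see that `P g` separates the community means by a fixed fraction of `‖P g‖`. The
difference of two means is `⟪z, P g⟫ = ⟪P z, g⟫`, a Gaussian with standard deviation about `√(K/n)`,
so it is rarely small. The norm `‖P g‖` is controlled by `K` Gaussian components, because the range
of `P` is close to the fixed space of `S`. A union bound over pairs of communities gives probability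
`0.9` (`measure_goodEvent`). -/

/-- A symmetric operator with `S³ = S` is a contraction. -/
lemma norm_apply_le_of_cube_eq {S : E →L[ℝ] E} (hS : ∀ u v, ⟪S u, v⟫ = ⟪u, S v⟫)
    (h3 : ∀ v, S (S (S v)) = S v) (v : E) : ‖S v‖ ≤ ‖v‖ := by
  -- Symmetry and `S⁴ = S²` give `‖S²v‖² = ⟪v, S²v⟫`, so Cauchy–Schwarz bounds `S²` first; then
  -- `‖Sv‖² = ⟪v, S²v⟫` bounds `S`.
  have h1 : ‖S (S v)‖ ≤ ‖v‖ := by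
    have h : ‖S (S v)‖ ^ 2 = ⟪v, S (S v)⟫ := by
      rw [← real_inner_self_eq_norm_sq, hS, hS, h3]
    have h' := real_inner_le_norm v (S (S v))
    rcases (norm_nonneg (S (S v))).eq_or_lt with h0 | h0
    · rw [← h0]; exact norm_nonneg _
    · nlinarith
  have h : ‖S v‖ ^ 2 = ⟪v, S (S v)⟫ := by rw [← real_inner_self_eq_norm_sq, hS]
  have h' := real_inner_le_norm v (S (S v))
  have := norm_nonneg v
  nlinarith [norm_nonneg (S v)]

/-- Parseval. In an eigenbasis it reduces norm bounds for functions of an operator to bounds on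
eigenvalues. -/
lemma norm_le_of_abs_inner_le {ι : Type*} [Fintype ι] (b : OrthonormalBasis ι ℝ E) {u v : E}
    {C : ℝ} (hC : 0 ≤ C) (h : ∀ i, |⟪b i, u⟫| ≤ C * |⟪b i, v⟫|) : ‖u‖ ≤ C * ‖v‖ := by
  have h2 : ‖u‖ ^ 2 ≤ (C * ‖v‖) ^ 2 := by
    rw [← b.sum_sq_norm_inner_right u, mul_pow, ← b.sum_sq_norm_inner_right v, Finset.mul_sum]
    refine Finset.sum_le_sum fun i _ => ?_
    rw [← mul_pow]
    exact pow_le_pow_left₀ (norm_nonneg _) (h i) 2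
  exact le_of_sq_le_sq h2 (by positivity)

/-- An eigenvector of a small perturbation of `h S`, where `S³ = S`, has an eigenvalue close to
one of `h`, `0`, `-h`. -/
lemma eigenvalue_localization {S F : E →L[ℝ] E} (hS : ∀ u v, ⟪S u, v⟫ = ⟪u, S v⟫)
    (h3 : ∀ v, S (S (S v)) = S v) {h f : ℝ} (hh : 0 < h) (hF : ∀ v, ‖F v‖ ≤ f * ‖v‖)
    (hf : 0 ≤ f) (hfh : f ≤ h) {φ : E} (hφ : ‖φ‖ = 1) {l : ℝ} (hl : h • S φ + F φ = l • φ) :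
    |l| ≤ 2 * h ∧ (h / 2 < l → |l - h| ≤ 16 * f) ∧ (l ≤ h / 2 → l ≤ 16 * f) := by
  have hS1 := norm_apply_le_of_cube_eq hS h3
  have h1 : |l| ≤ 2 * h := by
    have e : |l| = ‖h • S φ + F φ‖ := by rw [hl, norm_smul, hφ]; simp
    rw [e]
    refine (norm_add_le _ _).trans ?_
    rw [norm_smul, Real.norm_of_nonneg hh.le]
    have a := hS1 φ
    have b := hF φ
    rw [hφ] at a b
    nlinarith
  -- Substituting `h S φ = l φ - F φ` into `S³ = S` evaluates the polynomial `X (X - h) (X + h)` at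
  -- `l`, up to terms containing `F φ`.
  have key : (l * (l - h) * (l + h)) • φ =
      l ^ 2 • F φ + (l * h) • S (F φ) + h ^ 2 • S (S (F φ)) - h ^ 2 • F φ := by
    have e : F φ = l • φ - h • S φ := by rw [← hl]; abel
    rw [e]
    simp only [map_sub, map_smul, h3]
    module
  have hb : |l * (l - h) * (l + h)| ≤ 8 * h ^ 2 * f := by
    have e : |l * (l - h) * (l + h)| = ‖(l * (l - h) * (l + h)) • φ‖ := by
      rw [norm_smul, hφ]; simp
    rw [e, key]
    have n0 := hF φ
    have n1 := hS1 (F φ)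
    have n2 := hS1 (S (F φ))
    rw [hφ, mul_one] at n0
    have a0 : l ^ 2 ≤ 4 * h ^ 2 := by rw [← sq_abs]; nlinarith [abs_nonneg l]
    have a1 : |l * h| ≤ 2 * h ^ 2 := by rw [abs_mul, abs_of_pos hh]; nlinarith
    calc _ ≤ ‖l ^ 2 • F φ‖ + ‖(l * h) • S (F φ)‖ + ‖h ^ 2 • S (S (F φ))‖ + ‖h ^ 2 • F φ‖ :=
          (norm_sub_le _ _).trans (add_le_add_left (norm_add₃_le ..) _)
      _ = l ^ 2 * ‖F φ‖ + |l * h| * ‖S (F φ)‖ + h ^ 2 * ‖S (S (F φ))‖ + h ^ 2 * ‖F φ‖ := by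
          simp only [norm_smul, Real.norm_eq_abs, abs_pow, sq_abs]
      _ ≤ 4 * h ^ 2 * f + 2 * h ^ 2 * f + h ^ 2 * f + h ^ 2 * f := by gcongr <;> linarith
      _ = _ := by ring
  -- In each case the two factors away from zero have product at least `h²/2`, whence `16 f`. Below
  -- `h/2` only an upper bound is sought, since negative modes do not grow.
  refine ⟨h1, fun hlt => ?_, fun hle => ?_⟩
  · rw [abs_mul, abs_mul, abs_of_pos (by linarith : 0 < l), abs_of_pos (by linarith : 0 < l + h)]
      at hb
    have : h ^ 2 / 2 * |l - h| ≤ 8 * h ^ 2 * f := by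
      refine le_trans ?_ hb
      nlinarith [abs_nonneg (l - h), mul_nonneg (abs_nonneg (l - h))
        (by nlinarith : 0 ≤ l * (l + h) - h ^ 2 / 2)]
    have hh2 : 0 < h ^ 2 := by positivity
    nlinarith
  · by_contra! hc
    have hl0 : 0 < l := by linarith
    rw [abs_mul, abs_mul, abs_of_pos hl0, abs_of_pos (by linarith : 0 < l + h),
      abs_of_neg (by linarith : l - h < 0)] at hb
    have : h ^ 2 / 2 * l ≤ 8 * h ^ 2 * f := by
      refine le_trans ?_ hb
      nlinarith [mul_nonneg hl0.le (by nlinarith : 0 ≤ (h - l) * (l + h) - h ^ 2 / 2)]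
    have hh2 : 0 < h ^ 2 := by positivity
    nlinarith

/-- What is needed of the spectral projection `P` of `H = h S + F` onto the eigenvectors with
eigenvalue near `h`, where `‖F‖ ≤ f`. -/
structure IsTopProjection (S F P : E →L[ℝ] E) (h f : ℝ) : Prop where
  symm : ∀ u v, ⟪P u, v⟫ = ⟪u, P v⟫
  idem : ∀ v, P (P v) = P v
  comm : ∀ v, P (h • S v + F v) = h • S (P v) + F (P v)
  top : ∀ v, ‖h • S (P v) + F (P v) - h • P v‖ ≤ 16 * f * ‖P v‖
  bulk : ∀ η, 0 ≤ η → η * (2 * h) ≤ 1 → ∀ v,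
    ‖(v - P v) + η • (h • S (v - P v) + F (v - P v))‖ ≤ (1 + η * (16 * f)) * ‖v - P v‖
  near : ∀ v, S v = v → ‖v - P v‖ ≤ 2 / h * (f * ‖v‖)

lemma exists_isTopProjection [FiniteDimensional ℝ E] {S F : E →L[ℝ] E}
    (hS : ∀ u v, ⟪S u, v⟫ = ⟪u, S v⟫) (hFs : ∀ u v, ⟪F u, v⟫ = ⟪u, F v⟫)
    (h3 : ∀ v, S (S (S v)) = S v) {h f : ℝ} (hh : 0 < h) (hF : ∀ v, ‖F v‖ ≤ f * ‖v‖)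
    (hf : 0 ≤ f) (hfh : f ≤ h) : ∃ P : E →L[ℝ] E, IsTopProjection S F P h f := by
  classical
  set H : E →ₗ[ℝ] E := ((h • S + F : E →L[ℝ] E) : E →ₗ[ℝ] E) with hH
  have Happ : ∀ v, H v = h • S v + F v := fun v => rfl
  have hHs : H.IsSymmetric := fun u v => by
    simp only [Happ, inner_add_left, inner_add_right, inner_smul_left, inner_smul_right, hS, hFs]
    simp
  set b := hHs.eigenvectorBasis rfl with hb
  set l := hHs.eigenvalues rfl with hl
  have hbl : ∀ i, H (b i) = l i • b i := fun i => hHs.apply_eigenvectorBasis rfl i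
  have hloc := fun i => eigenvalue_localization hS h3 hh hF hf hfh (b.norm_eq_one i)
    ((Happ (b i)).symm.trans (hbl i))
  have hc : ∀ i v, ⟪b i, H v⟫ = l i * ⟪b i, v⟫ := fun i v => by
    rw [← hHs, hbl, inner_smul_left]; simp
  let P : E →L[ℝ] E := ∑ i ∈ Finset.univ.filter (fun i => h / 2 < l i),
    (innerSL ℝ (b i)).smulRight (b i)
  have Papp : ∀ v, P v = ∑ i ∈ Finset.univ.filter (fun i => h / 2 < l i), ⟪b i, v⟫ • b i := by
    intro v; simp [P]
  have hP : ∀ i v, ⟪b i, P v⟫ = if h / 2 < l i then ⟪b i, v⟫ else 0 := by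
    intro i v
    rw [Papp, inner_sum, Finset.sum_filter]
    simp_rw [inner_smul_right, orthonormal_iff_ite.1 b.orthonormal]
    rw [Finset.sum_eq_single i]
    · simp
    · intro j _ hj; simp [hj.symm]
    · simp
  have bext : ∀ u v : E, (∀ i, ⟪b i, u⟫ = ⟪b i, v⟫) → u = v := by
    intro u v huv
    apply b.repr.injective
    ext i
    simpa [b.repr_apply_apply] using huv i
  have hPs : ∀ u v, ⟪P u, v⟫ = ⟪u, P v⟫ := by
    intro u v
    rw [← b.sum_inner_mul_inner, ← b.sum_inner_mul_inner]
    refine Finset.sum_congr rfl fun i _ => ?_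
    rw [real_inner_comm, hP, hP]
    split_ifs <;> simp [real_inner_comm]
  refine ⟨P, hPs, ?_, ?_, ?_, ?_, ?_⟩
  · intro v
    refine bext _ _ fun i => ?_
    simp only [hP]; split_ifs <;> rfl
  · intro v
    refine bext _ _ fun i => ?_
    rw [← Happ, ← Happ, hP, hc, hc, hP]
    split_ifs <;> simp
  · intro v
    refine norm_le_of_abs_inner_le b (by positivity) fun i => ?_
    rw [← Happ, inner_sub_right, hc, inner_smul_right, hP]
    split_ifs with hi
    · rw [← sub_mul, abs_mul]
      exact mul_le_mul_of_nonneg_right ((hloc i).2.1 hi) (abs_nonneg _)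
    · simp
  · intro η hη hη2 v
    refine norm_le_of_abs_inner_le b (by positivity) fun i => ?_
    rw [← Happ, inner_add_right, inner_smul_right, hc, inner_sub_right, hP]
    split_ifs with hi
    · simp
    · rw [sub_zero, ← mul_assoc, ← one_add_mul, abs_mul]
      refine mul_le_mul_of_nonneg_right ?_ (abs_nonneg _)
      have h1 := (hloc i).2.2 (not_lt.1 hi)
      have h2 := abs_le.1 (hloc i).1
      have h4 : η * l i ≤ η * (16 * f) := mul_le_mul_of_nonneg_left h1 hη
      have h5 : η * (-(2 * h)) ≤ η * l i := mul_le_mul_of_nonneg_left h2.1 hη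
      -- The step size condition keeps `1 + η l` nonnegative for every eigenvalue `l ≥ -2h`, so only
      -- the upper bound on `l` matters.
      rw [abs_le]
      constructor <;> nlinarith [mul_nonneg hη hf]
  · intro v hv
    refine (norm_le_of_abs_inner_le b (v := F v) (by positivity) fun i => ?_).trans
      (mul_le_mul_of_nonneg_left (hF v) (by positivity))
    -- For a fixed vector `v` of `S`, each mode discarded by `P` contributes to `F v` with a factor
    -- `|l - h| ≥ h/2`.
    have e : F v = H v - h • v := by rw [Happ, hv]; abel
    rw [e, inner_sub_right, inner_sub_right, hc, inner_smul_right, hP]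
    split_ifs with hi
    · simp only [sub_self, abs_zero]; positivity
    · rw [sub_zero, ← sub_mul, abs_mul, ← mul_assoc]
      refine le_mul_of_one_le_left (abs_nonneg _) ?_
      rw [div_mul_eq_mul_div, le_div_iff₀ hh, abs_of_neg (by linarith)]
      linarith [not_lt.1 hi]

namespace IsTopProjection

variable {S F P : E →L[ℝ] E} {h f : ℝ}

lemma norm_apply_le (hP : IsTopProjection S F P h f) (v : E) : ‖P v‖ ≤ ‖v‖ :=
  norm_apply_le_of_cube_eq hP.symm (fun v => by rw [hP.idem, hP.idem]) v

lemma norm_sub_apply_le (hP : IsTopProjection S F P h f) (v : E) : ‖v - P v‖ ≤ ‖v‖ := by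
  have h2 : ‖v - P v‖ ^ 2 = ‖v‖ ^ 2 - ‖P v‖ ^ 2 := by
    rw [norm_sub_sq_real, ← real_inner_self_eq_norm_sq (P v), hP.symm, hP.idem]; ring
  nlinarith [sq_nonneg ‖P v‖, norm_nonneg v, norm_nonneg (v - P v)]

/-- The range of `P` nearly consists of fixed points of `S`. -/
lemma norm_sub_half_le (hP : IsTopProjection S F P h f) (hh : 0 < h)
    (hS : ∀ v, ‖S v‖ ≤ ‖v‖) (hF : ∀ v, ‖F v‖ ≤ f * ‖v‖) (v : E) :
    ‖P v - (1 / 2 : ℝ) • (S (S (P v)) + S (P v))‖ ≤ 26 * (f / h) * ‖P v‖ := by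
  set a := P v with ha
  have h1 : ‖S a - a‖ ≤ 17 * (f / h) * ‖a‖ := by
    have e : S a - a = h⁻¹ • ((h • S a + F a - h • a) - F a) := by
      rw [show (h • S a + F a - h • a) - F a = h • (S a - a) by module, smul_smul,
        inv_mul_cancel₀ hh.ne', one_smul]
    rw [e, norm_smul, norm_inv, Real.norm_of_nonneg hh.le]
    have := norm_sub_le (h • S a + F a - h • a) (F a)
    have h2 := hP.top v
    have h4 := hF a
    calc _ ≤ h⁻¹ * (16 * f * ‖a‖ + f * ‖a‖) := by gcongr; linarith
      _ = _ := by field_simp; ring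
  -- On the eigenvalues `1, 0, -1` of `S` the polynomial `(S² + S)/2` is the projection to the fixed
  -- space; the constant is `17 · 3/2 ≤ 26`.
  have e : a - (1 / 2 : ℝ) • (S (S a) + S a) =
      -((1 / 2 : ℝ) • S (S a - a) + (S a - a)) := by
    rw [map_sub]; module
  rw [e, norm_neg]
  refine (norm_add_le _ _).trans ?_
  rw [norm_smul, Real.norm_of_nonneg (by norm_num)]
  have := hS (S a - a)
  linarith [norm_nonneg (S a - a)]

end IsTopProjection

end Spectral

/-! ### Perturbed linear recurrences -/

/-- Discrete Grönwall inequality, from `1 + q ≤ exp q`. -/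
lemma le_exp_mul_of_recurrence {X : ℕ → ℝ} {q r : ℝ} (hq : 0 ≤ q) (hr : 0 ≤ r) {τ : ℕ}
    (h0 : 0 ≤ X 0) (hX : ∀ t < τ, X (t + 1) ≤ (1 + q) * X t + r) :
    ∀ t ≤ τ, X t ≤ Real.exp (q * t) * (X 0 + t * r) := by
  intro t
  induction t with
  | zero => intro _; simp
  | succ t ih =>
    intro ht
    have h1 := hX t (by omega)
    have h2 := ih (by omega)
    have e : Real.exp (q * ((t + 1 : ℕ) : ℝ)) = Real.exp q * Real.exp (q * t) := by
      rw [← Real.exp_add]; push_cast; ring_nf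
    have h4 : 1 + q ≤ Real.exp q := by linarith [Real.add_one_le_exp q]
    have h5 : 1 ≤ Real.exp q * Real.exp (q * t) := by
      rw [← Real.exp_add]; exact Real.one_le_exp (by positivity)
    rw [e]; push_cast
    calc X (t + 1) ≤ (1 + q) * (Real.exp (q * t) * (X 0 + t * r)) + r :=
          h1.trans (by gcongr)
      _ ≤ Real.exp q * (Real.exp (q * t) * (X 0 + t * r)) +
          (Real.exp q * Real.exp (q * t)) * r := by
          gcongr
          exact le_mul_of_one_le_left hr h5
      _ = _ := by ring

section Dynamics

variable {E : Type*} [NormedAddCommGroup E] [InnerProductSpace ℝ E]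
  {S F P : E →L[ℝ] E} {h f : ℝ}

/-- `P` commutes with `h S + F`, so `w - P w` obeys its own recurrence, with rate `16 η f` and not
`η h`. -/
lemma IsTopProjection.bulk_growth (hP : IsTopProjection S F P h f) {η ϱ : ℝ} (hη : 0 ≤ η)
    (hηh : η * (2 * h) ≤ 1) (hf : 0 ≤ f) (hϱ : 0 ≤ ϱ) {w r : ℕ → E} {τ : ℕ}
    (hw : ∀ t < τ, w (t + 1) = w t + η • (h • S (w t) + F (w t) + r t))
    (hr : ∀ t < τ, ‖r t‖ ≤ ϱ) (t : ℕ) (ht : t ≤ τ) :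
    ‖w t - P (w t)‖ ≤ Real.exp (η * (16 * f) * t) * (‖w 0 - P (w 0)‖ + t * (η * ϱ)) := by
  refine le_exp_mul_of_recurrence (X := fun t => ‖w t - P (w t)‖) (by positivity) (by positivity)
    (norm_nonneg _) (fun t ht => ?_) t ht
  have e : w (t + 1) - P (w (t + 1)) =
      ((w t - P (w t)) + η • (h • S (w t - P (w t)) + F (w t - P (w t)))) +
        η • (r t - P (r t)) := by
    rw [hw t ht]
    simp only [map_add, map_smul, map_sub]
    have := hP.comm (w t)
    rw [map_add, map_smul] at this
    rw [eq_sub_of_add_eq' this]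
    module
  rw [e]
  refine (norm_add_le _ _).trans (add_le_add (hP.bulk η hη hηh _) ?_)
  rw [norm_smul, Real.norm_of_nonneg hη]
  exact mul_le_mul_of_nonneg_left ((hP.norm_sub_apply_le _).trans (hr t ht)) hη

/-- Dividing `P w` by `(1 + η h)^t` leaves a drift of relative size `16 η f` per step. The constant
`‖P (w 0)‖` is added because the sum dominates the norm of the rescaled vector, which closes the
recurrence. -/
lemma IsTopProjection.top_growth (hP : IsTopProjection S F P h f) {η ϱ : ℝ} (hη : 0 ≤ η)
    (hh : 0 ≤ h) (hf : 0 ≤ f) (hϱ : 0 ≤ ϱ) {w r : ℕ → E} {τ : ℕ}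
    (hw : ∀ t < τ, w (t + 1) = w t + η • (h • S (w t) + F (w t) + r t))
    (hr : ∀ t < τ, ‖r t‖ ≤ ϱ) (t : ℕ) (ht : t ≤ τ) :
    ‖((1 + η * h) ^ t)⁻¹ • P (w t) - P (w 0)‖ + ‖P (w 0)‖ ≤
      Real.exp (η * (16 * f) * t) * (‖P (w 0)‖ + t * (η * ϱ)) := by
  have key := le_exp_mul_of_recurrence
    (X := fun t => ‖((1 + η * h) ^ t)⁻¹ • P (w t) - P (w 0)‖ + ‖P (w 0)‖)
    (q := η * (16 * f)) (r := η * ϱ) (τ := τ) (by positivity) (by positivity)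
    (by positivity) (fun t ht => ?_) t ht
  · simpa using key
  have hpos : 0 < 1 + η * h := by positivity
  set g := (1 + η * h) ^ t with hg
  have hgpos : 0 < g := by positivity
  have hg1 : (1 : ℝ) ≤ 1 + η * h := by nlinarith [mul_nonneg hη hh]
  have hgone : 1 ≤ g := one_le_pow₀ hg1
  set α := g⁻¹ • P (w t) with hα
  have hPw : P (w t) = g • α := by rw [hα, smul_smul, mul_inv_cancel₀ hgpos.ne', one_smul]
  have e : ((1 + η * h) ^ (t + 1))⁻¹ • P (w (t + 1)) - P (w 0) =
      (α - P (w 0)) + (η * (1 + η * h)⁻¹) • (g⁻¹ • (h • S (P (w t)) + F (P (w t)) - h • P (w t)) +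
        g⁻¹ • P (r t)) := by
    have h1 : P (w (t + 1)) = (1 + η * h) • P (w t) +
        η • (h • S (P (w t)) + F (P (w t)) - h • P (w t)) + η • P (r t) := by
      rw [hw t ht, map_add, map_smul, map_add, hP.comm]; module
    rw [h1, pow_succ, ← hg, mul_inv, hα]
    simp only [smul_add, smul_smul]
    rw [show g⁻¹ * (1 + η * h)⁻¹ * (1 + η * h) = g⁻¹ by field_simp,
      show g⁻¹ * (1 + η * h)⁻¹ * η = η * (1 + η * h)⁻¹ * g⁻¹ by ring]
    abel
  have hinv : (1 + η * h)⁻¹ ≤ 1 := inv_le_one_of_one_le₀ hg1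
  have hinvg : g⁻¹ ≤ 1 := inv_le_one_of_one_le₀ hgone
  have hαn : ‖α‖ ≤ ‖α - P (w 0)‖ + ‖P (w 0)‖ := by
    simpa using norm_add_le (α - P (w 0)) (P (w 0))
  have b1 : ‖g⁻¹ • (h • S (P (w t)) + F (P (w t)) - h • P (w t))‖ ≤ 16 * f * ‖α‖ := by
    rw [norm_smul, hα, norm_smul]
    calc _ ≤ ‖g⁻¹‖ * (16 * f * ‖P (w t)‖) := by gcongr; exact hP.top _
      _ = _ := by ring
  have b2 : ‖g⁻¹ • P (r t)‖ ≤ ϱ := by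
    rw [norm_smul, Real.norm_of_nonneg (by positivity)]
    calc _ ≤ 1 * ϱ := by
          gcongr
          exact (hP.norm_apply_le _).trans (hr t ht)
      _ = ϱ := one_mul _
  have b3 : ‖(η * (1 + η * h)⁻¹) • (g⁻¹ • (h • S (P (w t)) + F (P (w t)) - h • P (w t)) +
        g⁻¹ • P (r t))‖ ≤ η * (16 * f * ‖α‖ + ϱ) := by
    rw [norm_smul, Real.norm_of_nonneg (by positivity)]
    calc _ ≤ (η * 1) * (16 * f * ‖α‖ + ϱ) := by
          gcongr
          exact (norm_add_le _ _).trans (add_le_add b1 b2)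
      _ = _ := by ring
  have b4 := norm_add_le (α - P (w 0)) ((η * (1 + η * h)⁻¹) •
    (g⁻¹ • (h • S (P (w t)) + F (P (w t)) - h • P (w t)) + g⁻¹ • P (r t)))
  rw [← e] at b4
  have b5 : η * (16 * f) * ‖α‖ ≤ η * (16 * f) * (‖α - P (w 0)‖ + ‖P (w 0)‖) := by gcongr
  linarith

end Dynamics

/-! ### Off-diagonal block operators -/

section OffDiag

variable {n : ℕ}

/-- The symmetric operator with block matrix `[[0, X], [Xᵀ, 0]]`. -/
def offDiag (X : Matrix (Fin n) (Fin n) ℝ) : Emb n →L[ℝ] Emb n :=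
  Matrix.toEuclideanCLM (n := Fin n ⊕ Fin n) (𝕜 := ℝ) (Matrix.fromBlocks 0 X X.transpose 0)

lemma offDiag_inl (X : Matrix (Fin n) (Fin n) ℝ) (w : Emb n) (i : Fin n) :
    offDiag X w (Sum.inl i) = ∑ j, X i j * w (Sum.inr j) := by
  simp [offDiag, Matrix.mulVec, dotProduct]

lemma offDiag_inr (X : Matrix (Fin n) (Fin n) ℝ) (w : Emb n) (j : Fin n) :
    offDiag X w (Sum.inr j) = ∑ i, X i j * w (Sum.inl i) := by
  simp [offDiag, Matrix.mulVec, dotProduct]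

lemma emb_ext {u v : Emb n} (hl : ∀ i, u (Sum.inl i) = v (Sum.inl i))
    (hr : ∀ i, u (Sum.inr i) = v (Sum.inr i)) : u = v := by
  ext i
  rcases i with i | i
  · exact hl i
  · exact hr i

lemma inner_emb (u v : Emb n) :
    ⟪u, v⟫ = ∑ i, u (Sum.inl i) * v (Sum.inl i) + ∑ i, u (Sum.inr i) * v (Sum.inr i) := by
  simp [PiLp.inner_apply, mul_comm]

lemma norm_sq_emb (u : Emb n) :
    ‖u‖ ^ 2 = ∑ i, u (Sum.inl i) ^ 2 + ∑ i, u (Sum.inr i) ^ 2 := by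
  simp [EuclideanSpace.norm_sq_eq]

lemma offDiag_symm (X : Matrix (Fin n) (Fin n) ℝ) (u v : Emb n) :
    ⟪offDiag X u, v⟫ = ⟪u, offDiag X v⟫ := by
  simp only [inner_emb, offDiag_inl, offDiag_inr, Finset.sum_mul, Finset.mul_sum]
  rw [add_comm, Finset.sum_comm]
  congr 1
  · exact Finset.sum_congr rfl fun i _ => Finset.sum_congr rfl fun j _ => by ring
  · rw [Finset.sum_comm]
    exact Finset.sum_congr rfl fun i _ => Finset.sum_congr rfl fun j _ => by ring

lemma offDiag_add (X Y : Matrix (Fin n) (Fin n) ℝ) (w : Emb n) :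
    offDiag (X + Y) w = offDiag X w + offDiag Y w := by
  refine emb_ext (fun i => ?_) fun i => ?_ <;>
    simp [offDiag_inl, offDiag_inr, add_mul, Finset.sum_add_distrib]

lemma offDiag_smul (a : ℝ) (X : Matrix (Fin n) (Fin n) ℝ) (w : Emb n) :
    offDiag (a • X) w = a • offDiag X w := by
  refine emb_ext (fun i => ?_) fun i => ?_ <;>
    simp [offDiag_inl, offDiag_inr, mul_assoc, Finset.mul_sum]

/-! ### Spectral norms of matrices and of their block operators. -/

lemma specNorm_nonneg (X : Matrix (Fin n) (Fin n) ℝ) : 0 ≤ specNorm X := norm_nonneg _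

lemma sum_mulVec_sq_le (X : Matrix (Fin n) (Fin n) ℝ) (v : Fin n → ℝ) :
    ∑ i, (∑ j, X i j * v j) ^ 2 ≤ specNorm X ^ 2 * ∑ j, v j ^ 2 := by
  have h := (Matrix.toEuclideanCLM (n := Fin n) (𝕜 := ℝ) X).le_opNorm (WithLp.toLp 2 v)
  have h2 := pow_le_pow_left₀ (norm_nonneg _) h 2
  rw [mul_pow] at h2
  simpa [EuclideanSpace.norm_sq_eq, Matrix.mulVec, dotProduct, specNorm] using h2

lemma specNorm_transpose (X : Matrix (Fin n) (Fin n) ℝ) :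
    specNorm X.transpose = specNorm X := by
  have : X.transpose = star X := by
    ext i j; simp [Matrix.star_apply]
  rw [specNorm, specNorm, this, map_star, ContinuousLinearMap.star_eq_adjoint,
    LinearIsometryEquiv.norm_map]

lemma norm_offDiag_le (X : Matrix (Fin n) (Fin n) ℝ) (w : Emb n) :
    ‖offDiag X w‖ ≤ specNorm X * ‖w‖ := by
  have h2 : ‖offDiag X w‖ ^ 2 ≤ (specNorm X * ‖w‖) ^ 2 := by
    rw [mul_pow, norm_sq_emb, norm_sq_emb]
    simp only [offDiag_inl, offDiag_inr]
    have h1 := sum_mulVec_sq_le X fun j => w (Sum.inr j)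
    have h3 := sum_mulVec_sq_le X.transpose fun j => w (Sum.inl j)
    rw [specNorm_transpose] at h3
    simp only [Matrix.transpose_apply] at h3
    linarith
  exact le_of_sq_le_sq h2 (mul_nonneg (specNorm_nonneg _) (norm_nonneg _))

/-- The spectral norm is at most the Frobenius norm. -/
lemma specNorm_le_of_sum_sq_le {X : Matrix (Fin n) (Fin n) ℝ} {B : ℝ} (hB : 0 ≤ B)
    (h : ∑ i, ∑ j, X i j ^ 2 ≤ B ^ 2) : specNorm X ≤ B := by
  refine ContinuousLinearMap.opNorm_le_bound _ hB fun v => ?_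
  refine le_of_sq_le_sq ?_ (by positivity)
  rw [mul_pow, EuclideanSpace.norm_sq_eq, EuclideanSpace.norm_sq_eq]
  simp only [Matrix.ofLp_toEuclideanCLM, Matrix.mulVec, dotProduct, Real.norm_eq_abs, sq_abs]
  refine le_trans ?_ (mul_le_mul_of_nonneg_right h (by positivity))
  rw [Finset.sum_mul]
  exact Finset.sum_le_sum fun i _ => Finset.sum_mul_sq_le_sq_mul_sq _ _ _

lemma specNorm_mul_le (X Y : Matrix (Fin n) (Fin n) ℝ) :
    specNorm (X * Y) ≤ specNorm X * specNorm Y := by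
  rw [specNorm, map_mul]; exact norm_mul_le _ _

end OffDiag

/-! ### The expected co-occurrence matrix -/

section Block

variable {n K : ℕ}

/-- The matrix of the averaging operator. -/
def avgMat (n : ℕ) : Matrix (Fin n) (Fin n) ℝ := Matrix.of fun _ _ => 1 / (n : ℝ)

/-- The matrix of the operator that averages over the communities. -/
def blockAvg (σ : Fin n → Fin K) : Matrix (Fin n) (Fin n) ℝ :=
  Matrix.of fun i j => if σ i = σ j then (K : ℝ) / n else 0

/-- The projection onto the vectors that are constant on the communities and have mean zero. -/
def blockProj (σ : Fin n → Fin K) : Matrix (Fin n) (Fin n) ℝ := blockAvg σ - avgMat n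

lemma Balanced.card_eq {σ : Fin n → Fin K} (hσ : Balanced σ) (k : Fin K) :
    ((Finset.univ.filter fun i => σ i = k).card : ℝ) = n / K := by
  have hK : (K : ℝ) ≠ 0 := by
    have := k.pos
    positivity
  rw [eq_div_iff hK, mul_comm]
  exact_mod_cast hσ k

lemma Balanced.sum_comp {σ : Fin n → Fin K} (hσ : Balanced σ) (φ : Fin K → ℝ) :
    ∑ i, φ (σ i) = n / K * ∑ k, φ k := by
  rw [← Finset.sum_fiberwise Finset.univ σ, Finset.mul_sum]
  refine Finset.sum_congr rfl fun k _ => ?_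
  rw [Finset.sum_congr rfl (g := fun _ => φ k) (fun i hi => by rw [(Finset.mem_filter.1 hi).2]),
    Finset.sum_const, nsmul_eq_mul, hσ.card_eq]

lemma sum_ite_eq_comp (σ : Fin n → Fin K) (k : Fin K) (φ : Fin n → ℝ) :
    ∑ i, (if k = σ i then φ i else 0) = ∑ i ∈ Finset.univ.filter (fun i => σ i = k), φ i := by
  rw [Finset.sum_filter]
  exact Finset.sum_congr rfl fun i _ => by simp only [eq_comm]

lemma avgMat_mul_avgMat (hn : 0 < n) : avgMat n * avgMat n = avgMat n := by
  ext i j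
  have : (n : ℝ) ≠ 0 := by positivity
  simp [avgMat, Matrix.mul_apply]
  field_simp

variable {σ : Fin n → Fin K}

lemma blockAvg_mul_blockAvg (hσ : Balanced σ) (hn : 0 < n) :
    blockAvg σ * blockAvg σ = blockAvg σ := by
  ext i j
  have hn' : (n : ℝ) ≠ 0 := by positivity
  have hK : (K : ℝ) ≠ 0 := by
    have := (σ i).pos
    positivity
  have := hσ.sum_comp fun k =>
    (if σ i = k then (K : ℝ) / n else 0) * (if k = σ j then (K : ℝ) / n else 0)
  simp only [blockAvg, Matrix.mul_apply, Matrix.of_apply]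
  rw [this]
  simp only [ite_mul, zero_mul, Finset.sum_ite_eq, Finset.mem_univ, if_true]
  split_ifs
  · field_simp
  · simp

lemma blockAvg_mul_avgMat (hσ : Balanced σ) (hn : 0 < n) :
    blockAvg σ * avgMat n = avgMat n := by
  ext i j
  have hn' : (n : ℝ) ≠ 0 := by positivity
  have hK : (K : ℝ) ≠ 0 := by
    have := (σ i).pos
    positivity
  have := hσ.sum_comp fun k => (if σ i = k then (K : ℝ) / n else 0) * (1 / (n : ℝ))
  simp only [blockAvg, avgMat, Matrix.mul_apply, Matrix.of_apply]
  rw [this]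
  simp only [ite_mul, zero_mul, Finset.sum_ite_eq, Finset.mem_univ, if_true]
  field_simp

lemma blockAvg_transpose : (blockAvg σ).transpose = blockAvg σ := by
  ext i j
  simp only [blockAvg, Matrix.transpose_apply, Matrix.of_apply, eq_comm]

lemma avgMat_transpose : (avgMat n).transpose = avgMat n := by
  ext i j; simp [avgMat]

lemma avgMat_mul_blockAvg (hσ : Balanced σ) (hn : 0 < n) :
    avgMat n * blockAvg σ = avgMat n := by
  have := congrArg Matrix.transpose (blockAvg_mul_avgMat hσ hn)
  rwa [Matrix.transpose_mul, avgMat_transpose, blockAvg_transpose] at this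

lemma blockProj_transpose : (blockProj σ).transpose = blockProj σ := by
  rw [blockProj, Matrix.transpose_sub, avgMat_transpose, blockAvg_transpose]

lemma blockProj_mul_blockProj (hσ : Balanced σ) (hn : 0 < n) :
    blockProj σ * blockProj σ = blockProj σ := by
  simp only [blockProj, sub_mul, mul_sub, blockAvg_mul_blockAvg hσ hn, blockAvg_mul_avgMat hσ hn,
    avgMat_mul_blockAvg hσ hn, avgMat_mul_avgMat hn]
  abel

lemma blockProj_mul_avgMat (hσ : Balanced σ) (hn : 0 < n) : blockProj σ * avgMat n = 0 := by
  rw [blockProj, sub_mul, blockAvg_mul_avgMat hσ hn, avgMat_mul_avgMat hn, sub_self]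

lemma avgMat_mul_blockProj (hσ : Balanced σ) (hn : 0 < n) : avgMat n * blockProj σ = 0 := by
  rw [blockProj, mul_sub, avgMat_mul_blockAvg hσ hn, avgMat_mul_avgMat hn, sub_self]

/-- The second eigenvalue of the transition matrix of the expected adjacency matrix. -/
def secondEig (K : ℕ) (p q : ℝ) : ℝ := (p - q) / (p + ((K : ℝ) - 1) * q)

lemma sum_expAdj (hσ : Balanced σ) (p q : ℝ) (i : Fin n) :
    ∑ j, expAdj σ p q i j = expDeg n K p q := by
  have hK : (K : ℝ) ≠ 0 := by
    have := (σ i).pos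
    positivity
  have h := hσ.sum_comp fun k => if σ i = k then p else q
  simp only [expAdj, Matrix.of_apply]
  rw [h]
  have : ∑ k, (if σ i = k then p else q) = p + ((K : ℝ) - 1) * q := by
    have e : ∀ k, (if σ i = k then p else q) = q + if σ i = k then p - q else 0 := by
      intro k; split_ifs <;> ring
    simp_rw [e, Finset.sum_add_distrib]
    simp
    ring
  rw [this, expDeg]
  field_simp

lemma degMat_expAdj (hσ : Balanced σ) (p q : ℝ) :
    degMat (expAdj σ p q) = expDeg n K p q • (1 : Matrix (Fin n) (Fin n) ℝ) := by
  simp only [degMat, sum_expAdj hσ, Matrix.smul_one_eq_diagonal]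

/-- `avgMat n` and `blockProj σ` are idempotents with product zero, so this spectral decomposition
makes all powers explicit. -/
lemma transMat_expAdj (hσ : Balanced σ) (hK : 1 ≤ K) (hn : 0 < n) {p q : ℝ} (hp : 0 < p)
    (hq : 0 < q) :
    transMat (expAdj σ p q) = avgMat n + secondEig K p q • blockProj σ := by
  have hn' : (n : ℝ) ≠ 0 := by positivity
  have hK' : (1 : ℝ) ≤ K := by exact_mod_cast hK
  have hd : p + ((K : ℝ) - 1) * q ≠ 0 := by nlinarith
  have hd' : expDeg n K p q = n / K * (p + ((K : ℝ) - 1) * q) := by rw [expDeg]; ring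
  ext i j
  rw [transMat, Matrix.of_apply, sum_expAdj hσ, hd']
  simp only [Matrix.of_apply, Matrix.add_apply, Matrix.smul_apply,
    smul_eq_mul, avgMat, blockProj, Matrix.sub_apply, blockAvg, secondEig, expAdj]
  -- Eliminating `p` in favour of the denominator makes the latter an atom known to be nonzero.
  have hy : p = (p + ((K : ℝ) - 1) * q) - ((K : ℝ) - 1) * q := by ring
  generalize p + ((K : ℝ) - 1) * q = y at hy hd
  subst hy
  split_ifs
  · field_simp
    ring
  · field_simp
    ring

lemma transMat_expAdj_pow (hσ : Balanced σ) (hK : 1 ≤ K) (hn : 0 < n) {p q : ℝ} (hp : 0 < p)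
    (hq : 0 < q) {t : ℕ} (ht : 1 ≤ t) :
    transMat (expAdj σ p q) ^ t = avgMat n + secondEig K p q ^ t • blockProj σ := by
  induction t, ht using Nat.le_induction with
  | base => rw [pow_one, pow_one, transMat_expAdj hσ hK hn hp hq]
  | succ t ht ih =>
    rw [pow_succ, ih, transMat_expAdj hσ hK hn hp hq]
    simp only [add_mul, mul_add, smul_mul_assoc, mul_smul_comm, avgMat_mul_avgMat hn,
      avgMat_mul_blockProj hσ hn, blockProj_mul_avgMat hσ hn, blockProj_mul_blockProj hσ hn,
      smul_zero, add_zero, zero_add, smul_smul, pow_succ']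

/-- The total weight `2 ∑ (L - t)` of a co-occurrence matrix. -/
def totalWeight (L T : ℕ) : ℝ := 2 * ∑ t ∈ Finset.Icc 1 T, ((L : ℝ) - t)

/-- `n` times the eigenvalue of the expected co-occurrence matrix on the range of
`blockProj σ`. -/
def signalWeight (K L T : ℕ) (p q : ℝ) : ℝ :=
  2 * ∑ t ∈ Finset.Icc 1 T, ((L : ℝ) - t) * secondEig K p q ^ t

lemma expCooc_eq (hσ : Balanced σ) (hK : 1 ≤ K) (hn : 0 < n) {p q : ℝ} (hp : 0 < p)
    (hq : 0 < q) (L T : ℕ) :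
    expCooc σ p q L T = (totalWeight L T / n) • avgMat n +
      (signalWeight K L T p q / n) • blockProj σ := by
  have hn' : (n : ℝ) ≠ 0 := by positivity
  have hK' : (1 : ℝ) ≤ K := by exact_mod_cast hK
  have hd : 0 < p + ((K : ℝ) - 1) * q := by nlinarith
  have hd' : expDeg n K p q = n / K * (p + ((K : ℝ) - 1) * q) := by rw [expDeg]; ring
  have hd0 : expDeg n K p q ≠ 0 := by
    rw [hd']; positivity
  have e : ∀ t ∈ Finset.Icc 1 T, (((L : ℝ) - t) / ((n : ℝ) * expDeg n K p q)) •
      (degMat (expAdj σ p q) * transMat (expAdj σ p q) ^ t) =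
      (((L : ℝ) - t) / n) • avgMat n +
        ((((L : ℝ) - t) * secondEig K p q ^ t) / n) • blockProj σ := by
    intro t ht
    rw [transMat_expAdj_pow hσ hK hn hp hq (Finset.mem_Icc.1 ht).1, degMat_expAdj hσ,
      smul_mul_assoc, one_mul, smul_smul, smul_add, smul_smul]
    congr 2 <;> field_simp
  rw [expCooc, Finset.sum_congr rfl e, Finset.sum_add_distrib, ← Finset.sum_smul,
    ← Finset.sum_smul, smul_add, smul_smul, smul_smul, totalWeight, signalWeight,
    ← Finset.sum_div, ← Finset.sum_div]
  congr 2 <;> ring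

/-- The denominator is at most `K p`, so the relative gap `κ` bounds the eigenvalue below uniformly
in `p` and `q`. -/
lemma secondEig_mem {p q κ : ℝ} (hK : 1 ≤ K) (hq : 0 < q) (hqp : q < p) (hκ : κ * p ≤ p - q) :
    κ / K ≤ secondEig K p q ∧ 0 ≤ secondEig K p q ∧ secondEig K p q ≤ 1 := by
  have hK' : (1 : ℝ) ≤ K := by exact_mod_cast hK
  have hd : 0 < p + ((K : ℝ) - 1) * q := by nlinarith
  refine ⟨?_, div_nonneg (by linarith) hd.le, (div_le_one hd).2 (by nlinarith)⟩
  rw [secondEig, div_le_div_iff₀ (by linarith) hd]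
  have h2 : p + ((K : ℝ) - 1) * q ≤ K * p := by nlinarith
  by_cases h0 : 0 ≤ κ
  · nlinarith
  · nlinarith

/-- For the lower bound the term `t = 1` suffices, as all terms are nonnegative; for the upper bound
`secondEig ≤ 1`. Thus `n h` stays between constants independent of `n`, `p`, `q`. -/
lemma signalWeight_mem {L T : ℕ} {p q κ : ℝ} (hK : 1 ≤ K) (hT : 1 ≤ T) (hTL : T < L) (hq : 0 < q)
    (hqp : q < p) (hκ : κ * p ≤ p - q) :
    2 * (κ / K) ≤ signalWeight K L T p q ∧ signalWeight K L T p q ≤ totalWeight L T := by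
  obtain ⟨h1, h2, h3⟩ := secondEig_mem hK hq hqp hκ
  have hL : ∀ t ∈ Finset.Icc 1 T, (1 : ℝ) ≤ (L : ℝ) - t := by
    intro t ht
    have : t + 1 ≤ L := by have := (Finset.mem_Icc.1 ht).2; omega
    have : (t : ℝ) + 1 ≤ L := by exact_mod_cast this
    linarith
  constructor
  · rw [signalWeight]
    refine mul_le_mul_of_nonneg_left ?_ (by norm_num)
    have h4 := Finset.single_le_sum (f := fun t : ℕ => ((L : ℝ) - t) * secondEig K p q ^ t)
      (fun t ht => mul_nonneg (by linarith [hL t ht]) (pow_nonneg h2 t))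
      (Finset.mem_Icc.2 ⟨le_refl 1, hT⟩)
    have h5 := hL 1 (Finset.mem_Icc.2 ⟨le_refl 1, hT⟩)
    simp only [pow_one] at h4
    nlinarith
  · rw [signalWeight, totalWeight]
    refine mul_le_mul_of_nonneg_left (Finset.sum_le_sum fun t ht => ?_) (by norm_num)
    exact mul_le_of_le_one_right (by linarith [hL t ht]) (pow_le_one₀ h2 h3)

lemma totalWeight_pos {L T : ℕ} (hT : 1 ≤ T) (hTL : T < L) : 0 < totalWeight L T := by
  rw [totalWeight]
  refine mul_pos two_pos (Finset.sum_pos (fun t ht => ?_) ⟨1, Finset.mem_Icc.2 ⟨le_refl 1, hT⟩⟩)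
  have : t < L := by have := (Finset.mem_Icc.1 ht).2; omega
  have : (t : ℝ) < L := by exact_mod_cast this
  linarith

/-! ### The update as a perturbed linear map -/

/-- In both products row `i` is constant, equal to the degree of `i` over `n`. This makes the
gradient at uniform softmax equal to `-C * (1 - avgMat n)`. -/
lemma degMat_mul_avgMat (C : Matrix (Fin n) (Fin n) ℝ) :
    degMat C * avgMat n = C * avgMat n := by
  ext i j
  rw [degMat, Matrix.diagonal_mul, Matrix.mul_apply]
  simp [avgMat, Finset.sum_mul]

/-- Signal, linear noise and nonlinear remainder. The factor `1 - avgMat n` kills the large constant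
component of the expected matrix. -/
lemma neg_gradMat_eq (hσ : Balanced σ) (hK : 1 ≤ K) (hn : 0 < n) {p q : ℝ} (hp : 0 < p)
    (hq : 0 < q) (L T : ℕ) (C : Matrix (Fin n) (Fin n) ℝ) (w : Emb n) :
    -gradMat C w = (signalWeight K L T p q / n) • blockProj σ +
      (C - expCooc σ p q L T) * (1 - avgMat n) + -(degMat C * (softmax w - avgMat n)) := by
  have e : expCooc σ p q L T * (1 - avgMat n) = (signalWeight K L T p q / n) • blockProj σ := by
    rw [expCooc_eq hσ hK hn hp hq]
    simp only [mul_sub, mul_one, add_mul, smul_mul_assoc, avgMat_mul_avgMat hn,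
      blockProj_mul_avgMat hσ hn, smul_zero]
    abel
  rw [sub_mul, e, gradMat, mul_sub (degMat C), degMat_mul_avgMat]
  noncomm_ring

lemma step_eq (C : Matrix (Fin n) (Fin n) ℝ) (η : ℝ) (w : Emb n) :
    step C η w = w + η • offDiag (-gradMat C w) w := by
  refine emb_ext (fun i => ?_) fun i => ?_
  · simp [step, offDiag_inl, Matrix.mulVec, dotProduct, Matrix.one_apply, Finset.mul_sum,
      mul_assoc]
  · simp [step, offDiag_inr, Matrix.mulVec, dotProduct, Matrix.one_apply, Finset.mul_sum,
      mul_assoc, add_comm]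

/-- The square of the block matrix is `blockProj σ` on each half, because `blockProj σ` is a
symmetric idempotent. -/
lemma offDiag_blockProj_cube (hσ : Balanced σ) (hn : 0 < n) (w : Emb n) :
    offDiag (blockProj σ) (offDiag (blockProj σ) (offDiag (blockProj σ) w)) =
      offDiag (blockProj σ) w := by
  have h : (Matrix.fromBlocks 0 (blockProj σ) (blockProj σ).transpose 0 *
      (Matrix.fromBlocks 0 (blockProj σ) (blockProj σ).transpose 0 *
      Matrix.fromBlocks 0 (blockProj σ) (blockProj σ).transpose 0)) =
      (Matrix.fromBlocks 0 (blockProj σ) (blockProj σ).transpose 0 : Matrix _ _ ℝ) := by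
    simp [Matrix.fromBlocks_multiply, blockProj_transpose, blockProj_mul_blockProj hσ hn]
  have h2 := congrArg (Matrix.toEuclideanCLM (n := Fin n ⊕ Fin n) (𝕜 := ℝ)) h
  rw [map_mul, map_mul] at h2
  exact congrArg (fun A : Emb n →L[ℝ] Emb n => A w) h2

lemma specNorm_mul_one_sub_avgMat_le (hn : 0 < n) (R : Matrix (Fin n) (Fin n) ℝ) :
    specNorm (R * (1 - avgMat n)) ≤ 2 * specNorm R := by
  have hn' : (n : ℝ) ≠ 0 := by positivity
  have h1 : specNorm (avgMat n) ≤ 1 := by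
    refine specNorm_le_of_sum_sq_le zero_le_one ?_
    simp only [avgMat, Matrix.of_apply, Finset.sum_const, Finset.card_univ, Fintype.card_fin,
      nsmul_eq_mul]
    field_simp
    exact le_refl _
  have h2 : specNorm (R * (1 - avgMat n)) ≤ specNorm R + specNorm R * specNorm (avgMat n) := by
    rw [mul_sub, mul_one]
    refine le_trans ?_ (add_le_add_right (specNorm_mul_le R (avgMat n)) _)
    simp only [specNorm, map_sub]
    exact norm_sub_le _ _
  nlinarith [specNorm_nonneg R]

/-! ### Size of the nonlinear remainder. -/

lemma abs_le_norm_emb (w : Emb n) (i : Fin n ⊕ Fin n) : |w i| ≤ ‖w‖ := by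
  simpa using PiLp.norm_apply_le w i

/-- All exponents are at most `m = ‖w‖²` in absolute value, so `n Q_ij` lies between `exp (-2m)` and
`exp (2m)`; then `|exp u - 1| ≤ 2|u|`. -/
lemma abs_softmax_sub_le (hn : 0 < n) (w : Emb n) (hw : 2 * ‖w‖ ^ 2 ≤ 1) (i j : Fin n) :
    |softmax w i j - 1 / n| ≤ 4 * ‖w‖ ^ 2 / n := by
  have hn' : (0 : ℝ) < n := by positivity
  set m := ‖w‖ ^ 2 with hm
  have hxy : ∀ k, |w (Sum.inl i) * w (Sum.inr k)| ≤ m := by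
    intro k
    rw [abs_mul, hm, sq]
    exact mul_le_mul (abs_le_norm_emb _ _) (abs_le_norm_emb _ _) (abs_nonneg _) (norm_nonneg _)
  have hup : ∀ k, Real.exp (w (Sum.inl i) * w (Sum.inr k)) ≤ Real.exp m := fun k =>
    Real.exp_le_exp.2 (abs_le.1 (hxy k)).2
  have hlo : ∀ k, Real.exp (-m) ≤ Real.exp (w (Sum.inl i) * w (Sum.inr k)) := fun k =>
    Real.exp_le_exp.2 (abs_le.1 (hxy k)).1
  set Z := ∑ k, Real.exp (w (Sum.inl i) * w (Sum.inr k)) with hZ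
  have hZu : Z ≤ n * Real.exp m := by
    simpa using Finset.sum_le_card_nsmul Finset.univ _ _ (fun k _ => hup k)
  have hZl : n * Real.exp (-m) ≤ Z := by
    simpa using Finset.card_nsmul_le_sum Finset.univ _ _ (fun k _ => hlo k)
  have hZ0 : 0 < Z := lt_of_lt_of_le (by positivity) hZl
  have h1 := Real.abs_exp_sub_one_le (x := 2 * m) (by rw [abs_of_nonneg (by positivity)]; exact hw)
  have h2 := Real.abs_exp_sub_one_le (x := -(2 * m))
    (by rw [abs_neg, abs_of_nonneg (by positivity)]; exact hw)
  rw [abs_neg] at h2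
  rw [abs_of_nonneg (by positivity : 0 ≤ 2 * m)] at h1 h2
  have hsm : softmax w i j = Real.exp (w (Sum.inl i) * w (Sum.inr j)) / Z := rfl
  have u1 : softmax w i j ≤ Real.exp (2 * m) / n := by
    rw [hsm, div_le_div_iff₀ hZ0 hn']
    calc _ ≤ Real.exp m * n := by exact mul_le_mul_of_nonneg_right (hup j) hn'.le
      _ = Real.exp (2 * m) * (n * Real.exp (-m)) := by
          rw [show (2 * m) = m + m by ring, Real.exp_add, Real.exp_neg]; field_simp
      _ ≤ _ := by gcongr
  have l1 : Real.exp (-(2 * m)) / n ≤ softmax w i j := by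
    rw [hsm, div_le_div_iff₀ hn' hZ0]
    calc _ ≤ Real.exp (-(2 * m)) * (n * Real.exp m) := by gcongr
      _ = Real.exp (-m) * n := by
          rw [show (2 * m) = m + m by ring, neg_add, Real.exp_add, Real.exp_neg]; field_simp
      _ ≤ _ := by exact mul_le_mul_of_nonneg_right (hlo j) hn'.le
  have a1 : Real.exp (2 * m) ≤ 1 + 4 * m := by linarith [(abs_le.1 h1).2]
  have a2 : 1 - 4 * m ≤ Real.exp (-(2 * m)) := by linarith [(abs_le.1 h2).1]
  have a3 : Real.exp (2 * m) / n ≤ 1 / n + 4 * m / n := by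
    rw [← add_div]; gcongr
  have a4 : 1 / n - 4 * m / n ≤ Real.exp (-(2 * m)) / n := by
    rw [← sub_div]; gcongr
  rw [abs_le]
  constructor <;> linarith

/-- The expected matrix has constant row sums, so the degree vector is `(s/n) 𝟏 + R 𝟏` and the
spectral norm of `R` controls it in `ℓ²`; no degree is bounded individually. -/
lemma sum_deg_sq_le (hσ : Balanced σ) (hK : 1 ≤ K) (hn : 0 < n) {p q : ℝ} (hp : 0 < p)
    (hq : 0 < q) {L T : ℕ} (hs : 0 ≤ totalWeight L T) (C : Matrix (Fin n) (Fin n) ℝ) :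
    ∑ i, (∑ j, C i j) ^ 2 ≤
      ((totalWeight L T + n * specNorm (C - expCooc σ p q L T)) / Real.sqrt n) ^ 2 := by
  have hn' : (0 : ℝ) < n := by positivity
  set R := C - expCooc σ p q L T with hR
  set s := totalWeight L T with hs'
  have hrow : ∀ i, ∑ j, C i j = s / n + ∑ j, R i j * 1 := by
    intro i
    have hC : C = expCooc σ p q L T + R := by rw [hR]; abel
    have h1 := congrFun (congrFun (expCooc_eq (L := L) (T := T) hσ hK hn hp hq) i)
    have h2 : ∑ j, blockProj σ i j = 0 := by
      have h := congrFun (congrFun (blockProj_mul_avgMat hσ hn) i) i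
      simp only [Matrix.mul_apply, avgMat, Matrix.of_apply, ← Finset.sum_mul,
        Matrix.zero_apply] at h
      rcases mul_eq_zero.1 h with h | h
      · exact h
      · exact absurd h (by positivity)
    conv_lhs => rw [hC]
    simp only [Matrix.add_apply, h1, Matrix.smul_apply, smul_eq_mul, Finset.sum_add_distrib,
      ← Finset.mul_sum, h2, avgMat, Matrix.of_apply, Finset.sum_const, Finset.card_univ,
      Fintype.card_fin, nsmul_eq_mul, mul_one]
    field_simp
    ring
  have hR1 := sum_mulVec_sq_le R (fun _ => 1)
  simp only [one_pow, Finset.sum_const, Finset.card_univ, Fintype.card_fin, nsmul_eq_mul,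
    mul_one] at hR1
  set ν := specNorm R with hν
  have hν0 : 0 ≤ ν := specNorm_nonneg R
  have hcs : (∑ i, ∑ j, R i j) ≤ n * ν := by
    have h := Finset.sum_mul_sq_le_sq_mul_sq Finset.univ (fun i => ∑ j, R i j) (fun _ => (1 : ℝ))
    simp only [mul_one, one_pow, Finset.sum_const, Finset.card_univ, Fintype.card_fin,
      nsmul_eq_mul] at h
    refine le_of_sq_le_sq ?_ (by positivity)
    calc _ ≤ _ := h
      _ ≤ ν ^ 2 * n * n := by gcongr
      _ = _ := by ring
  simp only [hrow, mul_one, add_sq, Finset.sum_add_distrib, ← Finset.mul_sum, Finset.sum_const,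
    Finset.card_univ, Fintype.card_fin, nsmul_eq_mul]
  have e : ((s + n * ν) / Real.sqrt n) ^ 2 =
      n * (s / n) ^ 2 + 2 * (s / n) * (n * ν) + ν ^ 2 * n := by
    rw [div_pow, Real.sq_sqrt hn'.le]; field_simp; ring
  rw [e]
  gcongr

/-- The nonlinear part of the update is cubic in the iterate. -/
lemma norm_remainder_le (hσ : Balanced σ) (hK : 1 ≤ K) (hn : 0 < n) {p q : ℝ} (hp : 0 < p)
    (hq : 0 < q) {L T : ℕ} (hs : 0 ≤ totalWeight L T) (C : Matrix (Fin n) (Fin n) ℝ) (w : Emb n)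
    (hw : 2 * ‖w‖ ^ 2 ≤ 1) :
    ‖offDiag (-(degMat C * (softmax w - avgMat n))) w‖ ≤
      4 * (totalWeight L T + n * specNorm (C - expCooc σ p q L T)) / n * ‖w‖ ^ 2 * ‖w‖ := by
  have hn' : (0 : ℝ) < n := by positivity
  have hν0 := specNorm_nonneg (C - expCooc σ p q L T)
  refine (norm_offDiag_le _ _).trans (mul_le_mul_of_nonneg_right ?_ (norm_nonneg _))
  refine specNorm_le_of_sum_sq_le (by positivity) ?_
  have h1 := sum_deg_sq_le hσ hK hn hp hq hs C
  set D := totalWeight L T + n * specNorm (C - expCooc σ p q L T) with hD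
  calc ∑ i, ∑ j, (-(degMat C * (softmax w - avgMat n))) i j ^ 2
      = ∑ i, (∑ j, C i j) ^ 2 * ∑ j, (softmax w i j - 1 / n) ^ 2 := by
        refine Finset.sum_congr rfl fun i _ => ?_
        rw [Finset.mul_sum]
        refine Finset.sum_congr rfl fun j _ => ?_
        simp only [Matrix.neg_apply, degMat, Matrix.diagonal_mul, Matrix.sub_apply, avgMat,
          Matrix.of_apply]
        ring
    _ ≤ ∑ i, (∑ j, C i j) ^ 2 * (n * (4 * ‖w‖ ^ 2 / n) ^ 2) := by
        refine Finset.sum_le_sum fun i _ => mul_le_mul_of_nonneg_left ?_ (sq_nonneg _)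
        have := Finset.sum_le_card_nsmul Finset.univ (fun j => (softmax w i j - 1 / n) ^ 2)
          ((4 * ‖w‖ ^ 2 / n) ^ 2) (fun j _ => by
            rw [← sq_abs]
            exact pow_le_pow_left₀ (abs_nonneg _) (abs_softmax_sub_le hn w hw i j) 2)
        simpa using this
    _ ≤ (D / Real.sqrt n) ^ 2 * (n * (4 * ‖w‖ ^ 2 / n) ^ 2) := by
        rw [← Finset.sum_mul]
        gcongr
    _ = _ := by
        rw [div_pow, Real.sq_sqrt hn'.le]
        field_simp

end Block

/-! ### Test vectors -/

section TestVectors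

variable {n K : ℕ} {σ : Fin n → Fin K}

/-- The normalized indicator of a community, in both the node and the context coordinates. -/
def blockVec (σ : Fin n → Fin K) (k : Fin K) : Emb n :=
  WithLp.toLp 2 (Sum.elim (fun r => if σ r = k then Real.sqrt (K / (2 * n)) else 0)
    (fun r => if σ r = k then Real.sqrt (K / (2 * n)) else 0))

/-- The vector representing the difference of the means over two communities. -/
def meanDiff (σ : Fin n → Fin K) (i j : Fin K) : Emb n :=
  WithLp.toLp 2 (Sum.elim
    (fun r => (if σ r = i then (K : ℝ) / n else 0) - (if σ r = j then (K : ℝ) / n else 0))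
    (fun _ => 0))

/-- The projection of `meanDiff σ i j` to the fixed space of `offDiag (blockProj σ)`. -/
def symMeanDiff (σ : Fin n → Fin K) (i j : Fin K) : Emb n :=
  WithLp.toLp 2 (Sum.elim
    (fun r => ((if σ r = i then (K : ℝ) / n else 0) - (if σ r = j then (K : ℝ) / n else 0)) / 2)
    (fun r => ((if σ r = i then (K : ℝ) / n else 0) - (if σ r = j then (K : ℝ) / n else 0)) / 2))

lemma natCast_pos_of_fin (k : Fin K) : (0 : ℝ) < K := by
  have := k.pos
  positivity

lemma inner_meanDiff (hσ : Balanced σ) (i j : Fin K) (w : Emb n) :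
    ⟪meanDiff σ i j, w⟫ = clusterMean σ w i - clusterMean σ w j := by
  rw [inner_emb]
  simp only [meanDiff, Sum.elim_inl, Sum.elim_inr, zero_mul, Finset.sum_const_zero, add_zero,
    sub_mul, Finset.sum_sub_distrib, ite_mul, clusterMean, hσ.card_eq, Finset.sum_filter]
  congr 1 <;>
  · rw [Finset.sum_div]
    refine Finset.sum_congr rfl fun r _ => ?_
    split_ifs
    · rw [div_div_eq_mul_div]; ring
    · simp

lemma sum_ite_sub_ite_sq {i j : Fin K} (hij : i ≠ j) (a : ℝ) :
    ∑ k, ((if k = i then a else 0) - (if k = j then a else 0)) ^ 2 = 2 * a ^ 2 := by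
  have e : ∀ k, ((if k = i then a else 0) - (if k = j then a else 0)) ^ 2 =
      (if k = i then a ^ 2 else 0) + (if k = j then a ^ 2 else 0) := by
    intro k
    by_cases h1 : k = i
    · subst h1; simp [hij]
    · simp [h1]
  simp_rw [e, Finset.sum_add_distrib]
  simp
  ring

lemma norm_sq_meanDiff (hσ : Balanced σ) {i j : Fin K} (hij : i ≠ j) (hn : 0 < n) :
    ‖meanDiff σ i j‖ ^ 2 = 2 * K / n := by
  have hK := natCast_pos_of_fin i
  have hn' : (0 : ℝ) < n := by positivity
  rw [norm_sq_emb]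
  simp only [meanDiff, Sum.elim_inl, Sum.elim_inr]
  rw [hσ.sum_comp (fun k => ((if k = i then (K : ℝ) / n else 0) -
    (if k = j then (K : ℝ) / n else 0)) ^ 2), sum_ite_sub_ite_sq hij]
  simp
  field_simp

lemma norm_sq_symMeanDiff (hσ : Balanced σ) {i j : Fin K} (hij : i ≠ j) (hn : 0 < n) :
    ‖symMeanDiff σ i j‖ ^ 2 = K / n := by
  have hK := natCast_pos_of_fin i
  have hn' : (0 : ℝ) < n := by positivity
  rw [norm_sq_emb]
  simp only [symMeanDiff, Sum.elim_inl, Sum.elim_inr, div_pow]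
  rw [← Finset.sum_div, hσ.sum_comp (fun k => ((if k = i then (K : ℝ) / n else 0) -
    (if k = j then (K : ℝ) / n else 0)) ^ 2), sum_ite_sub_ite_sq hij]
  field_simp
  norm_num

lemma inner_meanDiff_symMeanDiff (hσ : Balanced σ) {i j : Fin K} (hij : i ≠ j) (hn : 0 < n) :
    ⟪meanDiff σ i j, symMeanDiff σ i j⟫ = K / n := by
  have hK := natCast_pos_of_fin i
  have hn' : (0 : ℝ) < n := by positivity
  rw [inner_emb]
  simp only [meanDiff, symMeanDiff, Sum.elim_inl, Sum.elim_inr, mul_div_assoc', ← sq, zero_mul,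
    Finset.sum_const_zero, zero_div, add_zero]
  rw [← Finset.sum_div, hσ.sum_comp (fun k => ((if k = i then (K : ℝ) / n else 0) -
    (if k = j then (K : ℝ) / n else 0)) ^ 2), sum_ite_sub_ite_sq hij]
  field_simp

lemma sum_blockProj_mul (σ : Fin n → Fin K) (r : Fin n) (v : Fin n → ℝ) :
    ∑ s, blockProj σ r s * v s =
      K / n * ∑ s ∈ Finset.univ.filter (fun s => σ s = σ r), v s - (∑ s, v s) / n := by
  simp only [blockProj, Matrix.sub_apply, blockAvg, avgMat, Matrix.of_apply, sub_mul,
    Finset.sum_sub_distrib, ite_mul, zero_mul]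
  rw [← sum_ite_eq_comp, Finset.mul_sum, Finset.sum_div]
  congr 1
  · exact Finset.sum_congr rfl fun s _ => by split_ifs <;> simp
  · exact Finset.sum_congr rfl fun s _ => by ring

lemma blockProj_comm (σ : Fin n → Fin K) (r s : Fin n) : blockProj σ s r = blockProj σ r s :=
  congrFun (congrFun (blockProj_transpose (σ := σ)) r) s

lemma offDiag_symMeanDiff (hσ : Balanced σ) {i j : Fin K} (hn : 0 < n) :
    offDiag (blockProj σ) (symMeanDiff σ i j) = symMeanDiff σ i j := by
  have hK := natCast_pos_of_fin i
  have hn' : (0 : ℝ) < n := by positivity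
  have key : ∀ r, ∑ s, blockProj σ r s * (((if σ s = i then (K : ℝ) / n else 0) -
      (if σ s = j then (K : ℝ) / n else 0)) / 2) = ((if σ r = i then (K : ℝ) / n else 0) -
      (if σ r = j then (K : ℝ) / n else 0)) / 2 := by
    intro r
    rw [sum_blockProj_mul, hσ.sum_comp (fun k => ((if k = i then (K : ℝ) / n else 0) -
      (if k = j then (K : ℝ) / n else 0)) / 2)]
    rw [Finset.sum_congr rfl (g := fun _ => ((if σ r = i then (K : ℝ) / n else 0) -
      (if σ r = j then (K : ℝ) / n else 0)) / 2)
      (fun s hs => by rw [(Finset.mem_filter.1 hs).2])]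
    rw [Finset.sum_const, nsmul_eq_mul, hσ.card_eq, ← Finset.sum_div, Finset.sum_sub_distrib]
    simp only [Finset.sum_ite_eq', Finset.mem_univ, if_true, sub_self, zero_div, mul_zero, sub_zero]
    rw [← mul_assoc, div_mul_div_comm, mul_comm (n : ℝ), div_self (by positivity), one_mul]
  refine emb_ext (fun r => ?_) fun r => ?_
  · rw [offDiag_inl]; exact key r
  · rw [offDiag_inr]
    simp_rw [blockProj_comm σ r]
    exact key r

lemma norm_blockVec (hσ : Balanced σ) (k : Fin K) (hn : 0 < n) : ‖blockVec σ k‖ = 1 := by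
  have hK := natCast_pos_of_fin k
  have hn' : (0 : ℝ) < n := by positivity
  have h : ‖blockVec σ k‖ ^ 2 = 1 := by
    rw [norm_sq_emb]
    simp only [blockVec, Sum.elim_inl, Sum.elim_inr, ite_pow, Real.sq_sqrt
      (by positivity : 0 ≤ (K : ℝ) / (2 * n))]
    rw [hσ.sum_comp (fun k' => if k' = k then (K : ℝ) / (2 * n) else 0 ^ 2)]
    simp
    field_simp
    norm_num
  rwa [pow_eq_one_iff_of_nonneg (norm_nonneg _) two_ne_zero] at h

lemma inner_blockVec (σ : Fin n → Fin K) (k : Fin K) (a : Emb n) :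
    ⟪blockVec σ k, a⟫ = Real.sqrt (K / (2 * n)) *
      ∑ r ∈ Finset.univ.filter (fun r => σ r = k), (a (Sum.inl r) + a (Sum.inr r)) := by
  rw [inner_emb]
  simp only [blockVec, Sum.elim_inl, Sum.elim_inr, ite_mul, zero_mul, Finset.sum_filter]
  rw [← Finset.sum_add_distrib, Finset.mul_sum]
  exact Finset.sum_congr rfl fun r _ => by split_ifs <;> ring

/-- The projection to the fixed space of `offDiag (blockProj σ)` is determined by the components
along the vectors `blockVec σ k`. -/
lemma norm_sq_half_le (hσ : Balanced σ) (hn : 0 < n) (a : Emb n) :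
    ‖(1 / 2 : ℝ) • (offDiag (blockProj σ) (offDiag (blockProj σ) a) + offDiag (blockProj σ) a)‖ ^ 2
      ≤ ∑ k, ⟪blockVec σ k, a⟫ ^ 2 := by
  have hK : (0 : ℝ) < K := natCast_pos_of_fin (σ ⟨0, hn⟩)
  have hn' : (0 : ℝ) < n := by positivity
  set S := offDiag (blockProj σ) with hS
  let y : Fin n → ℝ := fun r => a (Sum.inl r) + a (Sum.inr r)
  let M : Fin K → ℝ := fun k => ∑ r ∈ Finset.univ.filter (fun r => σ r = k), y r
  have hidem : ∀ (v : Fin n → ℝ) r, ∑ s, blockProj σ r s * ∑ t, blockProj σ s t * v t =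
      ∑ t, blockProj σ r t * v t := by
    intro v r
    have h := congrFun (congrArg (fun A => A.mulVec v) (blockProj_mul_blockProj hσ hn)) r
    simp only [← Matrix.mulVec_mulVec] at h
    simpa [Matrix.mulVec, dotProduct] using h
  have hsum : ∑ r, y r = ∑ k, M k := (Finset.sum_fiberwise _ _ _).symm
  -- The projection to the fixed space symmetrizes the two halves and keeps only the centred
  -- community sums `M k` of `x + y`.
  have hl : ∀ r, ((1 / 2 : ℝ) • (S (S a) + S a)) (Sum.inl r) =
      (K / n * M (σ r) - (∑ k, M k) / n) / 2 := by
    intro r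
    rw [← hsum, ← sum_blockProj_mul]
    simp only [PiLp.smul_apply, PiLp.add_apply, hS, offDiag_inl, offDiag_inr, smul_eq_mul]
    have h1 := hidem (fun t => a (Sum.inl t)) r
    simp_rw [blockProj_comm σ] at h1 ⊢
    simp only [y, mul_add, Finset.sum_add_distrib]
    simp only [h1]
    ring
  have hr : ∀ r, ((1 / 2 : ℝ) • (S (S a) + S a)) (Sum.inr r) =
      (K / n * M (σ r) - (∑ k, M k) / n) / 2 := by
    intro r
    rw [← hsum, ← sum_blockProj_mul]
    simp only [PiLp.smul_apply, PiLp.add_apply, hS, offDiag_inl, offDiag_inr, smul_eq_mul]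
    have h1 := hidem (fun t => a (Sum.inr t)) r
    have h2 : ∀ v : Fin n → ℝ, ∑ t, blockProj σ t r * v t = ∑ t, blockProj σ r t * v t :=
      fun v => Finset.sum_congr rfl fun t _ => by rw [blockProj_comm]
    simp only [y, mul_add, Finset.sum_add_distrib, h2, h1]
    ring
  have e1 : ‖(1 / 2 : ℝ) • (S (S a) + S a)‖ ^ 2 =
      (K / (2 * n)) * ∑ k, (M k - (∑ k, M k) / K) ^ 2 := by
    rw [norm_sq_emb]
    simp only [hl, hr]
    rw [hσ.sum_comp (fun k => ((K / n * M k - (∑ k, M k) / n) / 2) ^ 2), ← two_mul,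
      Finset.mul_sum, Finset.mul_sum, Finset.mul_sum]
    refine Finset.sum_congr rfl fun k _ => ?_
    field_simp
  have e2 : ∑ k, ⟪blockVec σ k, a⟫ ^ 2 = (K / (2 * n)) * ∑ k, M k ^ 2 := by
    simp only [inner_blockVec, mul_pow, Real.sq_sqrt (by positivity : 0 ≤ (K : ℝ) / (2 * n))]
    rw [Finset.mul_sum]
  rw [e1, e2]
  refine mul_le_mul_of_nonneg_left ?_ (by positivity)
  -- Centring the numbers `M k` can only decrease their sum of squares.
  set m := (∑ k, M k) / K with hm
  have hmK : ∑ k, M k = K * m := by rw [hm]; field_simp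
  simp only [sub_sq, Finset.sum_add_distrib, Finset.sum_sub_distrib, ← Finset.mul_sum,
    ← Finset.sum_mul, hmK]
  simp
  nlinarith [mul_nonneg hK.le (sq_nonneg m)]

end TestVectors

/-! ### Gaussian estimates -/

section Gaussian

lemma integral_pow_six_gaussianReal_one : ∫ x, x ^ 6 ∂(gaussianReal 0 1) = 15 := by
  rw [integral_gaussianReal_eq_integral_smul one_ne_zero]
  have e : ∀ x : ℝ, gaussianPDFReal 0 1 x • x ^ 6 =
      (fun y => (Real.sqrt (2 * Real.pi))⁻¹ * (y ^ (6 : ℝ) * Real.exp (-(1 / 2) * y ^ (2 : ℝ))))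
        |x| := by
    intro x
    have h6 : |x| ^ (6 : ℝ) = x ^ 6 := by
      rw [show (6 : ℝ) = ((6 : ℕ) : ℝ) by norm_num, Real.rpow_natCast]
      exact Even.pow_abs (by decide) x
    have h2 : |x| ^ (2 : ℝ) = x ^ 2 := by
      rw [show (2 : ℝ) = ((2 : ℕ) : ℝ) by norm_num, Real.rpow_natCast]
      exact Even.pow_abs (by decide) x
    simp only [h6, h2, gaussianPDFReal, smul_eq_mul, NNReal.coe_one, mul_one, sub_zero]
    rw [show -(1 / 2) * x ^ 2 = -x ^ 2 / 2 by ring]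
    ring
  rw [integral_congr_ae (Filter.Eventually.of_forall e), integral_comp_abs (f := fun y : ℝ =>
    (Real.sqrt (2 * Real.pi))⁻¹ * (y ^ (6 : ℝ) * Real.exp (-(1 / 2) * y ^ (2 : ℝ)))),
    integral_const_mul, integral_rpow_mul_exp_neg_mul_rpow (by norm_num)
    (by norm_num) (by norm_num)]
  have hG : Real.Gamma ((6 + 1) / 2) = 15 * Real.sqrt Real.pi / 8 := by
    have := Real.Gamma_nat_add_half 3
    rw [show ((6 : ℝ) + 1) / 2 = ((3 : ℕ) : ℝ) + 1 / 2 by norm_num, this]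
    norm_num [Nat.doubleFactorial]
  have hp : (1 / 2 : ℝ) ^ (-(6 + 1) / 2 : ℝ) = 8 * Real.sqrt 2 := by
    rw [one_div, Real.inv_rpow (by norm_num), ← Real.rpow_neg (by norm_num),
      show (-(-(6 + 1) / 2) : ℝ) = (3 : ℕ) + 1 / 2 by norm_num, Real.rpow_add (by norm_num),
      Real.rpow_natCast, ← Real.sqrt_eq_rpow]
    norm_num
  rw [hG, hp, Real.sqrt_mul (by norm_num)]
  have : Real.sqrt Real.pi ≠ 0 := (Real.sqrt_pos.2 Real.pi_pos).ne'
  have : Real.sqrt 2 ≠ 0 := by positivity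
  field_simp

lemma integral_pow_six_gaussianReal (v : NNReal) :
    ∫ x, x ^ 6 ∂(gaussianReal 0 v) = 15 * (v : ℝ) ^ 3 := by
  have h : gaussianReal 0 v = (gaussianReal 0 1).map (fun x => Real.sqrt v * x) := by
    rw [gaussianReal_map_const_mul]
    congr 1
    · simp
    · ext; simp
  rw [h, integral_map (by fun_prop) (by fun_prop)]
  simp_rw [mul_pow]
  rw [integral_const_mul, integral_pow_six_gaussianReal_one,
    show Real.sqrt v ^ 6 = (Real.sqrt v ^ 2) ^ 3 by ring, Real.sq_sqrt v.coe_nonneg]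
  ring

/-- The Gaussian density is at most its value at the mean. -/
lemma gaussianReal_abs_lt_le {v : NNReal} (hv : v ≠ 0) {s : ℝ} (hs : 0 ≤ s) :
    (gaussianReal 0 v).real {x | |x| < s} ≤ 2 * s / Real.sqrt (2 * Real.pi * v) := by
  have hv' : (0 : ℝ) < v := by exact_mod_cast pos_iff_ne_zero.2 hv
  have hset : {x : ℝ | |x| < s} = Set.Ioo (-s) s := by ext x; simp [abs_lt]
  have hpdf : ∀ x, gaussianPDF 0 v x ≤ ENNReal.ofReal ((Real.sqrt (2 * Real.pi * v))⁻¹) := by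
    intro x
    refine ENNReal.ofReal_le_ofReal ?_
    rw [gaussianPDFReal]
    refine mul_le_of_le_one_right (by positivity) (Real.exp_le_one_iff.2 ?_)
    rw [neg_div]
    exact neg_nonpos.2 (by positivity)
  refine ENNReal.toReal_le_of_le_ofReal (by positivity) ?_
  rw [gaussianReal_apply 0 hv, hset]
  calc _ ≤ ∫⁻ _ in Set.Ioo (-s) s, ENNReal.ofReal ((Real.sqrt (2 * Real.pi * v))⁻¹) :=
        lintegral_mono fun x => hpdf x
    _ = ENNReal.ofReal ((Real.sqrt (2 * Real.pi * v))⁻¹) * ENNReal.ofReal (s - -s) := by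
        rw [setLIntegral_const, Real.volume_Ioo]
    _ ≤ _ := by
        rw [← ENNReal.ofReal_mul (by positivity)]
        exact ENNReal.ofReal_le_ofReal (le_of_eq (by ring))

variable {n : ℕ}

lemma initLaw_eq (n : ℕ) : initLaw n = stdGaussian (Emb n) := map_pi_eq_stdGaussian

instance (n : ℕ) : IsProbabilityMeasure (initLaw n) := by
  rw [initLaw_eq]; infer_instance

lemma initLaw_map_inner (v : Emb n) :
    (initLaw n).map (fun g => ⟪v, g⟫) = gaussianReal 0 (‖v‖₊ ^ 2) := by
  have h := IsGaussian.map_eq_gaussianReal (μ := stdGaussian (Emb n)) (innerSL ℝ v)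
  rw [initLaw_eq]
  rw [variance_dual_stdGaussian, innerSL_apply_norm, integral_strongDual_stdGaussian] at h
  rw [show (fun g => ⟪v, g⟫) = ⇑(innerSL ℝ v) from rfl, h]
  congr 1
  ext
  simp

lemma initLaw_abs_inner_lt_le {v : Emb n} (hv : v ≠ 0) {s : ℝ} (hs : 0 ≤ s) :
    (initLaw n).real {g | |⟪v, g⟫| < s} ≤ 2 * s / (Real.sqrt (2 * Real.pi) * ‖v‖) := by
  have h := gaussianReal_abs_lt_le (v := ‖v‖₊ ^ 2) (by simpa using hv) hs
  rw [← initLaw_map_inner, map_measureReal_apply (by fun_prop)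
    (measurableSet_lt (by fun_prop) (by fun_prop))] at h
  refine h.trans (le_of_eq ?_)
  rw [Real.sqrt_mul (by positivity)]
  simp

lemma integrable_inner_pow (v : Emb n) (m : ℕ) :
    Integrable (fun g => ⟪v, g⟫ ^ m) (initLaw n) := by
  have h : Integrable (fun x : ℝ => x ^ m) ((initLaw n).map (fun g => ⟪v, g⟫)) := by
    rw [initLaw_map_inner]
    have := (memLp_id_gaussianReal (μ := 0) (v := ‖v‖₊ ^ 2) (m : NNReal))
    have h2 := MemLp.integrable_norm_pow' (p := m) (by simpa using this)
    refine (integrable_norm_iff (by fun_prop)).1 (h2.congr (Filter.Eventually.of_forall fun x => ?_))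
    simp
  exact h.comp_measurable (by fun_prop)

lemma integral_inner_pow_six (v : Emb n) : ∫ g, ⟪v, g⟫ ^ 6 ∂(initLaw n) = 15 * ‖v‖ ^ 6 := by
  have h := integral_pow_six_gaussianReal (‖v‖₊ ^ 2)
  rw [← initLaw_map_inner, integral_map (by fun_prop) (by fun_prop)] at h
  rw [h]
  push_cast
  ring

lemma integral_inner_sq (v : Emb n) : ∫ g, ⟪v, g⟫ ^ 2 ∂(initLaw n) = ‖v‖ ^ 2 := by
  have h : ∫ x, x ^ 2 ∂(gaussianReal 0 (‖v‖₊ ^ 2)) = ‖v‖ ^ 2 := by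
    have h1 := variance_of_integral_eq_zero (X := id) (μ := gaussianReal 0 (‖v‖₊ ^ 2))
      aemeasurable_id (by simp)
    rw [variance_id_gaussianReal] at h1
    simpa using h1.symm
  rw [← initLaw_map_inner, integral_map (by fun_prop) (by fun_prop)] at h
  exact h

/-- Markov's inequality for the cube of the sum, via `(∑ a_k)³ ≤ K² ∑ a_k³` and the sixth moment
`15`; no independence of the components is needed. Lower powers would give `1/9` and `1/27`, too
much next to the `1/15` lost in `measure_goodEvent`. -/
lemma initLaw_sum_inner_sq_ge_le {K : ℕ} (hK : 0 < K) (v : Fin K → Emb n)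
    (hv : ∀ k, ‖v k‖ ≤ 1) :
    (initLaw n).real {g | 9 * (K : ℝ) ≤ ∑ k, ⟪v k, g⟫ ^ 2} ≤ 15 / 729 := by
  have hK' : (0 : ℝ) < K := by positivity
  have hint : Integrable (fun g => (K : ℝ) ^ 2 * ∑ k, ⟪v k, g⟫ ^ 6) (initLaw n) :=
    (integrable_finsetSum _ fun k _ => integrable_inner_pow (v k) 6).const_mul _
  have hM := mul_meas_ge_le_integral_of_nonneg (μ := initLaw n)
    (f := fun g => (K : ℝ) ^ 2 * ∑ k, ⟪v k, g⟫ ^ 6)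
    (Filter.Eventually.of_forall fun g => mul_nonneg (by positivity)
      (Finset.sum_nonneg fun k _ => Even.pow_nonneg (by decide) _)) hint (729 * (K : ℝ) ^ 3)
  have hI : ∫ g, (K : ℝ) ^ 2 * ∑ k, ⟪v k, g⟫ ^ 6 ∂(initLaw n) ≤ 15 * (K : ℝ) ^ 3 := by
    rw [integral_const_mul, integral_finsetSum _ fun k _ => integrable_inner_pow (v k) 6]
    simp_rw [integral_inner_pow_six]
    have : ∑ k, 15 * ‖v k‖ ^ 6 ≤ ∑ _k : Fin K, (15 : ℝ) :=
      Finset.sum_le_sum fun k _ => by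
        have := pow_le_one₀ (n := 6) (norm_nonneg _) (hv k)
        linarith
    simp only [Finset.sum_const, Finset.card_univ, Fintype.card_fin, nsmul_eq_mul] at this
    calc _ ≤ (K : ℝ) ^ 2 * (K * 15) := by gcongr
      _ = _ := by ring
  have hsub : {g : Emb n | 9 * (K : ℝ) ≤ ∑ k, ⟪v k, g⟫ ^ 2} ⊆
      {g | 729 * (K : ℝ) ^ 3 ≤ (K : ℝ) ^ 2 * ∑ k, ⟪v k, g⟫ ^ 6} := by
    intro g hg
    have h1 := pow_sum_div_card_le_sum_pow (s := Finset.univ) (f := fun k => ⟪v k, g⟫ ^ 2)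
      (fun k _ => sq_nonneg _) 2
    simp only [Finset.card_univ, Fintype.card_fin, ← pow_mul] at h1
    rw [div_le_iff₀ (by positivity)] at h1
    have h2 := pow_le_pow_left₀ (by positivity) (show 9 * (K : ℝ) ≤ ∑ k, ⟪v k, g⟫ ^ 2 from hg) 3
    change 729 * (K : ℝ) ^ 3 ≤ (K : ℝ) ^ 2 * ∑ k, ⟪v k, g⟫ ^ 6
    norm_num at h1
    nlinarith
  have := measureReal_mono (μ := initLaw n) hsub
  rw [le_div_iff₀ (by norm_num)]
  have h3 : 0 < (K : ℝ) ^ 3 := by positivity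
  nlinarith

lemma initLaw_norm_sq_ge_le (hn : 0 < n) :
    (initLaw n).real {g | 2000 * (n : ℝ) ≤ ‖g‖ ^ 2} ≤ 1 / 1000 := by
  have hn' : (0 : ℝ) < n := by positivity
  have e : ∀ g : Emb n, ‖g‖ ^ 2 = ∑ i, ⟪EuclideanSpace.single i (1 : ℝ), g⟫ ^ 2 := by
    intro g
    simp [EuclideanSpace.norm_sq_eq, EuclideanSpace.inner_single_left]
  simp_rw [e]
  have hM := mul_meas_ge_le_integral_of_nonneg (μ := initLaw n)
    (f := fun g : Emb n => ∑ i, ⟪EuclideanSpace.single i (1 : ℝ), g⟫ ^ 2)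
    (Filter.Eventually.of_forall fun g => Finset.sum_nonneg fun k _ => sq_nonneg _)
    (integrable_finsetSum _ fun k _ => integrable_inner_pow _ 2) (2000 * (n : ℝ))
  rw [integral_finsetSum _ fun k _ => integrable_inner_pow _ 2] at hM
  simp only [integral_inner_sq, PiLp.norm_single, norm_one, one_pow, Finset.sum_const,
    Finset.card_univ, Fintype.card_sum, Fintype.card_fin, nsmul_eq_mul] at hM
  push_cast at hM
  rw [le_div_iff₀ (by norm_num)]
  nlinarith

end Gaussian

/-! ### The good event -/

section GoodEvent

variable {n K : ℕ}

lemma card_filter_lt_le (K : ℕ) :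
    2 * (Finset.univ.filter fun e : Fin K × Fin K => e.1 < e.2).card ≤ K ^ 2 := by
  have h1 : (Finset.univ.filter fun e : Fin K × Fin K => e.2 < e.1).card =
      (Finset.univ.filter fun e : Fin K × Fin K => e.1 < e.2).card :=
    Finset.card_equiv (Equiv.prodComm _ _) (by simp)
  have h2 : Disjoint (Finset.univ.filter fun e : Fin K × Fin K => e.1 < e.2)
      (Finset.univ.filter fun e : Fin K × Fin K => e.2 < e.1) :=
    Finset.disjoint_filter.2 fun e _ h => not_lt.2 h.le
  have h3 := Finset.card_le_univ ((Finset.univ.filter fun e : Fin K × Fin K => e.1 < e.2) ∪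
    (Finset.univ.filter fun e : Fin K × Fin K => e.2 < e.1))
  rw [Finset.card_union_of_disjoint h2, h1] at h3
  simp only [Fintype.card_prod, Fintype.card_fin] at h3
  nlinarith

/-- The initializations for which the components along the given directions are controlled. -/
def goodEvent (e : Fin K → Emb n) (z : Fin K → Fin K → Emb n) : Set (Emb n) :=
  {g | ∑ k, ⟪e k, g⟫ ^ 2 < 9 * (K : ℝ) ∧
    (∀ i j, i < j → 3.3 * Real.sqrt K / (20 * (K : ℝ) ^ 2 * Real.sqrt n) ≤ |⟪z i j, g⟫|) ∧
    ‖g‖ ^ 2 < 2000 * (n : ℝ)}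

/-- Union bound: the failure probabilities `15/729`, `1/15` and `1/1000` add up to less than `0.1`.
-/
lemma measure_goodEvent (hK : 0 < K) (hn : 0 < n) (e : Fin K → Emb n) (z : Fin K → Fin K → Emb n)
    (he : ∀ k, ‖e k‖ ≤ 1) (hz : ∀ i j, i < j → 0.99 * Real.sqrt (K / n) ≤ ‖z i j‖) :
    ENNReal.ofReal 0.9 ≤ initLaw n (goodEvent e z) := by
  have hK' : (0 : ℝ) < K := by positivity
  have hn' : (0 : ℝ) < n := by positivity
  set s := 3.3 * Real.sqrt K / (20 * (K : ℝ) ^ 2 * Real.sqrt n) with hs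
  have hs0 : 0 ≤ s := by positivity
  set I := Finset.univ.filter fun e : Fin K × Fin K => e.1 < e.2 with hI
  -- The density bound gives `2 · 3.3 / (20 · 2.5 · 0.99) = 2/15`, over `K²`; there are at most
  -- `K²/2` pairs.
  have hpair : ∀ x ∈ I, (initLaw n).real {g | |⟪z x.1 x.2, g⟫| < s} ≤ (2 / 15) / (K : ℝ) ^ 2 := by
    intro x hx
    have hx' := hz x.1 x.2 (Finset.mem_filter.1 hx).2
    have hpos : 0 < 0.99 * Real.sqrt (K / n) := by positivity
    have hz0 : z x.1 x.2 ≠ 0 := norm_pos_iff.1 (hpos.trans_le hx')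
    refine (initLaw_abs_inner_lt_le hz0 hs0).trans ?_
    have hpi : (2.5 : ℝ) ≤ Real.sqrt (2 * Real.pi) := by
      refine Real.le_sqrt_of_sq_le ?_
      nlinarith [Real.pi_gt_d2]
    calc _ ≤ 2 * s / (2.5 * (0.99 * Real.sqrt (K / n))) := by gcongr
      _ = _ := by
        rw [hs, Real.sqrt_div hK'.le]
        field_simp
        norm_num
  have hb : (initLaw n).real (⋃ x ∈ I, {g | |⟪z x.1 x.2, g⟫| < s}) ≤ 1 / 15 := by
    refine (measureReal_biUnion_finset_le I _).trans ?_
    refine (Finset.sum_le_card_nsmul I _ _ hpair).trans ?_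
    have hc : 2 * (I.card : ℝ) ≤ (K : ℝ) ^ 2 := by exact_mod_cast card_filter_lt_le K
    rw [nsmul_eq_mul, mul_div_assoc', div_le_iff₀ (by positivity)]
    linarith
  have ha := initLaw_sum_inner_sq_ge_le hK e he
  have hc := initLaw_norm_sq_ge_le hn
  set A := {g : Emb n | 9 * (K : ℝ) ≤ ∑ k, ⟪e k, g⟫ ^ 2} with hA
  set B := ⋃ x ∈ I, {g : Emb n | |⟪z x.1 x.2, g⟫| < s} with hB
  set D := {g : Emb n | 2000 * (n : ℝ) ≤ ‖g‖ ^ 2} with hD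
  have hmA : MeasurableSet A := measurableSet_le (by fun_prop) (by fun_prop)
  have hmB : MeasurableSet B := Finset.measurableSet_biUnion _ fun x _ =>
    measurableSet_lt (by fun_prop) (by fun_prop)
  have hmD : MeasurableSet D := measurableSet_le (by fun_prop) (by fun_prop)
  have hbad : (initLaw n).real (A ∪ B ∪ D) ≤ 0.1 := by
    have h1 := measureReal_union_le (μ := initLaw n) (A ∪ B) D
    have h2 := measureReal_union_le (μ := initLaw n) A B
    linarith
  have hcompl := probReal_compl_eq_one_sub (μ := initLaw n) ((hmA.union hmB).union hmD)
  have hsub : (A ∪ B ∪ D)ᶜ ⊆ goodEvent e z := by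
    intro g hg
    rw [Set.mem_compl_iff, Set.mem_union, Set.mem_union, not_or, not_or] at hg
    obtain ⟨⟨h1, h2⟩, h3⟩ := hg
    refine ⟨not_le.1 h1, fun i j hij => not_lt.1 fun h => h2 ?_, not_le.1 h3⟩
    exact Set.mem_biUnion (x := (i, j)) (by simp [hI, hij]) h
  have h4 : 0.9 ≤ (initLaw n).real (goodEvent e z) := by
    have := measureReal_mono (μ := initLaw n) hsub
    linarith
  exact ENNReal.ofReal_le_of_le_toReal h4

end GoodEvent

/-! ### Exit of the iteration from a ball -/

section Exit

variable {E : Type*} [NormedAddCommGroup E] [InnerProductSpace ℝ E]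
  {S F P : E →L[ℝ] E} {h f : ℝ}

/-- The iteration leaves the ball of radius `B` within `N₀` steps, at a point which is close to a
multiple of the projection of the starting point. -/
lemma IsTopProjection.exists_exit (hP : IsTopProjection S F P h f) {η ϱ δ B : ℝ} (hη : 0 ≤ η)
    (hh : 0 ≤ h) (hηh : η * (2 * h) ≤ 1) (hf : 0 ≤ f) (hϱ : 0 ≤ ϱ) (hδ : 0 ≤ δ) (hδ1 : δ ≤ 1 / 10)
    {w : ℕ → E} (hw : ∀ t, ‖w t‖ ≤ B → ∃ r : E,
      w (t + 1) = w t + η • (h • S (w t) + F (w t) + r) ∧ ‖r‖ ≤ ϱ)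
    (hw0 : ‖w 0‖ ≤ B) {N₀ : ℕ} (hN₀ : 1 ≤ N₀) (hexp : Real.exp (η * (16 * f) * N₀) ≤ 1 + δ)
    (hnoise : N₀ * (η * ϱ) ≤ δ * ‖P (w 0)‖)
    (hgrow : B ≤ (1 + η * h) ^ N₀ * (‖P (w 0)‖ / 2)) :
    ∃ t, 1 ≤ t ∧ B ≤ ‖w t‖ ∧ (∀ s, 1 ≤ s → s < t → ‖w s‖ < B) ∧
      ‖w t - P (w t)‖ ≤ 2 * ‖w 0‖ ∧
      ‖((1 + η * h) ^ t)⁻¹ • P (w t) - P (w 0)‖ ≤ 3 * δ * ‖P (w 0)‖ := by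
  classical
  -- The remainder is only known inside the ball; outside, `0` is a dummy value.
  have hr : ∀ t, ∃ r : E, ‖w t‖ ≤ B →
      (w (t + 1) = w t + η • (h • S (w t) + F (w t) + r) ∧ ‖r‖ ≤ ϱ) := by
    intro t
    by_cases ht : ‖w t‖ ≤ B
    · obtain ⟨r, hr⟩ := hw t ht
      exact ⟨r, fun _ => hr⟩
    · exact ⟨0, fun h => absurd h ht⟩
  choose r hr using hr
  have hP0 := norm_nonneg (P (w 0))
  -- Only the iterates before `t` need to lie in the ball, so the bounds also hold at the exit time.
  -- Time `0`, ignored by the stopping rule, is covered by `hw0`.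
  have main : ∀ t, t ≤ N₀ → (∀ s, 1 ≤ s → s < t → ‖w s‖ < B) →
      ‖w t - P (w t)‖ ≤ 2 * ‖w 0‖ ∧
      ‖((1 + η * h) ^ t)⁻¹ • P (w t) - P (w 0)‖ ≤ 3 * δ * ‖P (w 0)‖ := by
    intro t htN hs
    have hle : ∀ s < t, ‖w s‖ ≤ B := by
      intro s hst
      rcases Nat.eq_zero_or_pos s with rfl | h0
      · exact hw0
      · exact (hs s h0 hst).le
    have htN' : (t : ℝ) ≤ N₀ := by exact_mod_cast htN
    have hexp' : Real.exp (η * (16 * f) * t) ≤ 1 + δ := by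
      refine le_trans (Real.exp_le_exp.2 ?_) hexp
      gcongr
    have hnoise' : t * (η * ϱ) ≤ δ * ‖P (w 0)‖ := by
      refine le_trans ?_ hnoise
      gcongr
    have hb := hP.bulk_growth hη hηh hf hϱ (τ := t) (fun s hst => (hr s (hle s hst)).1)
      (fun s hst => (hr s (hle s hst)).2) t le_rfl
    have ht := hP.top_growth hη hh hf hϱ (τ := t) (fun s hst => (hr s (hle s hst)).1)
      (fun s hst => (hr s (hle s hst)).2) t le_rfl
    constructor
    · refine hb.trans ?_
      have h1 := hP.norm_sub_apply_le (w 0)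
      have h2 := hP.norm_apply_le (w 0)
      calc _ ≤ (1 + δ) * (‖w 0‖ + δ * ‖w 0‖) :=
            mul_le_mul hexp' (add_le_add h1 (hnoise'.trans (mul_le_mul_of_nonneg_left h2 hδ)))
              (by positivity) (by positivity)
        _ = (1 + δ) ^ 2 * ‖w 0‖ := by ring
        _ ≤ 2 * ‖w 0‖ := by gcongr; nlinarith
    · have : Real.exp (η * (16 * f) * t) * (‖P (w 0)‖ + t * (η * ϱ)) ≤
          (1 + δ) * (‖P (w 0)‖ + δ * ‖P (w 0)‖) := by gcongr
      nlinarith [mul_nonneg hδ hP0, mul_nonneg (mul_nonneg hδ (sub_nonneg.2 hδ1)) hP0]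
  -- Otherwise the bounds hold at `N₀`, where `‖P w‖` is at least `(1 + η h)^N₀ (1 - 3δ) ‖P (w 0)‖`,
  -- already beyond `B`.
  have hex : ∃ t, 1 ≤ t ∧ t ≤ N₀ ∧ B ≤ ‖w t‖ := by
    by_contra! hcon
    have h1 := (main N₀ le_rfl fun s h1 h2 => hcon s h1 h2.le).2
    have hg : 0 < (1 + η * h) ^ N₀ := by positivity
    have h2 := hcon N₀ hN₀ le_rfl
    set α := ((1 + η * h) ^ N₀)⁻¹ • P (w N₀) with hα
    have h3 : ‖P (w 0)‖ ≤ ‖α‖ + ‖α - P (w 0)‖ := by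
      have := norm_sub_le α (α - P (w 0))
      simpa using this
    have h4 : ‖P (w 0)‖ / 2 ≤ ‖α‖ := by nlinarith
    have h5 : ‖P (w N₀)‖ = (1 + η * h) ^ N₀ * ‖α‖ := by
      rw [hα, norm_smul, norm_inv, Real.norm_of_nonneg hg.le]; field_simp
    have h6 := hP.norm_apply_le (w N₀)
    have h7 : (1 + η * h) ^ N₀ * (‖P (w 0)‖ / 2) ≤ (1 + η * h) ^ N₀ * ‖α‖ := by gcongr
    linarith
  refine ⟨Nat.find hex, (Nat.find_spec hex).1, (Nat.find_spec hex).2.2, ?_, ?_⟩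
  all_goals
    have hmin : ∀ s, 1 ≤ s → s < Nat.find hex → ‖w s‖ < B := fun s h1 h2 =>
      not_le.1 fun h3 => Nat.find_min hex h2 ⟨h1, h2.le.trans (Nat.find_spec hex).2.1, h3⟩
  · exact hmin
  · exact main _ (Nat.find_spec hex).2.1 hmin

/-- The output `w` is close to `γ a₀` with `γ` unknown; the exit condition `B ≤ ‖w‖` bounds `γ ‖a₀‖`
below. -/
lemma le_abs_inner_of_near {z w a a₀ : E} {γ δ c₁ ε B : ℝ} (hγ : 0 < γ)
    (hb : ‖w - a‖ ≤ 2 * ε) (ha : ‖γ⁻¹ • a - a₀‖ ≤ 3 * δ * ‖a₀‖) (hB : B ≤ ‖w‖) (hδ : 0 ≤ δ)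
    (hz : c₁ * ‖a₀‖ ≤ |⟪z, a₀⟫|) (hc₁ : 3 * δ * ‖z‖ ≤ c₁) :
    (B - 2 * ε) / (1 + 3 * δ) * (c₁ - 3 * δ * ‖z‖) - 2 * ε * ‖z‖ ≤ |⟪z, w⟫| := by
  set α := γ⁻¹ • a with hα
  have haα : a = γ • α := by rw [hα, smul_smul, mul_inv_cancel₀ hγ.ne', one_smul]
  have h1 : ‖α‖ ≤ (1 + 3 * δ) * ‖a₀‖ := by
    have := norm_add_le (α - a₀) a₀
    rw [sub_add_cancel] at this
    linarith
  have h2 : B - 2 * ε ≤ ‖a‖ := by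
    have := norm_add_le (w - a) a
    rw [sub_add_cancel] at this
    linarith
  have h3 : (c₁ - 3 * δ * ‖z‖) * ‖a₀‖ ≤ |⟪z, α⟫| := by
    have e : ⟪z, α⟫ = ⟪z, a₀⟫ + ⟪z, α - a₀⟫ := by rw [← inner_add_right]; congr 1; abel
    have h4 := abs_real_inner_le_norm z (α - a₀)
    have h5 := abs_sub_abs_le_abs_sub ⟪z, a₀⟫ (-⟪z, α - a₀⟫)
    rw [sub_neg_eq_add, ← e, abs_neg] at h5
    have h6 : ‖z‖ * ‖α - a₀‖ ≤ ‖z‖ * (3 * δ * ‖a₀‖) := by gcongr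
    nlinarith
  have h4 : (B - 2 * ε) / (1 + 3 * δ) ≤ γ * ‖a₀‖ := by
    rw [div_le_iff₀ (by positivity)]
    calc _ ≤ ‖a‖ := h2
      _ = γ * ‖α‖ := by rw [haα, norm_smul, Real.norm_of_nonneg hγ.le]
      _ ≤ γ * ((1 + 3 * δ) * ‖a₀‖) := by gcongr
      _ = _ := by ring
  have h5 : (B - 2 * ε) / (1 + 3 * δ) * (c₁ - 3 * δ * ‖z‖) ≤ |⟪z, a⟫| := by
    rw [haα, inner_smul_right, abs_mul, abs_of_pos hγ]
    calc _ ≤ (γ * ‖a₀‖) * (c₁ - 3 * δ * ‖z‖) :=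
          mul_le_mul_of_nonneg_right h4 (sub_nonneg.2 hc₁)
      _ = γ * ((c₁ - 3 * δ * ‖z‖) * ‖a₀‖) := by ring
      _ ≤ _ := by gcongr
  have e : ⟪z, w⟫ = ⟪z, a⟫ + ⟪z, w - a⟫ := by rw [← inner_add_right]; congr 1; abel
  have h6 := abs_real_inner_le_norm z (w - a)
  have h7 := abs_sub_abs_le_abs_sub ⟪z, a⟫ (-⟪z, w - a⟫)
  rw [sub_neg_eq_add, ← e, abs_neg] at h7
  have h8 : ‖z‖ * ‖w - a‖ ≤ ‖z‖ * (2 * ε) := by gcongr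
  linarith

end Exit

/-! ### Sufficiently large numbers of vertices -/

section Large

/-- The conditions on the number of vertices, where `s` is the total weight of the co-occurrence
matrix, `b` a lower bound for the signal and `δ` the accuracy. -/
structure IsLarge (K : ℕ) (ρ c s b η₀ δ : ℝ) (n : ℕ) : Prop where
  pos : 0 < n
  gap : 5200 * c * (n : ℝ) ^ (-(ρ / 2)) ≤ b
  stepSize : 2 * η₀ * s ≤ n
  stepSize_horizon : 2 * η₀ ≤ (n : ℝ) ^ (1 + ρ / 4)
  drift : Real.exp (32 * c * (n : ℝ) ^ (-(ρ / 4))) ≤ 1 + δ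
  noise : 2000 * (K : ℝ) ^ 2 * (s + c) * (n : ℝ) ^ (ρ / 4 - 1 / 3) ≤ δ
  growth : 1000 * (K : ℝ) ^ 2 * (n : ℝ) ^ (2 / 3 : ℝ) ≤ Real.exp (b / 4 * (n : ℝ) ^ (ρ / 4))
  radius : 8000 * (K : ℝ) ^ 3 ≤ (n : ℝ) ^ (1 / 6 : ℝ)

-- Negative powers of `n` vanish, with `ρ/4 < 1/3` because `ρ < 1`, and the exponential of `n^(ρ/4)`
-- beats every power of `n`.
open Filter Topology in
lemma eventually_isLarge (K : ℕ) {ρ c s b η₀ δ : ℝ} (hρ : 0 < ρ) (hρ1 : ρ < 1) (hb : 0 < b)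
    (hδ : 0 < δ) : ∀ᶠ n : ℕ in atTop, IsLarge K ρ c s b η₀ δ n := by
  have hcast : Tendsto (fun n : ℕ => (n : ℝ)) atTop atTop := tendsto_natCast_atTop_atTop
  have hneg : ∀ a : ℝ, 0 < a → Tendsto (fun n : ℕ => (n : ℝ) ^ (-a)) atTop (𝓝 0) :=
    fun a ha => (tendsto_rpow_neg_atTop ha).comp hcast
  have hpos : ∀ a : ℝ, 0 < a → Tendsto (fun n : ℕ => (n : ℝ) ^ a) atTop atTop :=
    fun a ha => (tendsto_rpow_atTop ha).comp hcast
  have h1 : ∀ᶠ n : ℕ in atTop, 5200 * c * (n : ℝ) ^ (-(ρ / 2)) ≤ b := by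
    have := (hneg (ρ / 2) (by positivity)).const_mul (5200 * c)
    rw [mul_zero] at this
    exact this.eventually_le_const hb
  have h2 : ∀ᶠ n : ℕ in atTop, Real.exp (32 * c * (n : ℝ) ^ (-(ρ / 4))) ≤ 1 + δ := by
    have := (hneg (ρ / 4) (by positivity)).const_mul (32 * c)
    rw [mul_zero] at this
    have := (Real.continuous_exp.tendsto 0).comp this
    rw [Real.exp_zero] at this
    exact this.eventually_le_const (by linarith)
  have h3 : ∀ᶠ n : ℕ in atTop,
      2000 * (K : ℝ) ^ 2 * (s + c) * (n : ℝ) ^ (ρ / 4 - 1 / 3) ≤ δ := by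
    have := (hneg (1 / 3 - ρ / 4) (by linarith)).const_mul (2000 * (K : ℝ) ^ 2 * (s + c))
    rw [mul_zero, neg_sub] at this
    exact this.eventually_le_const hδ
  have h4 : ∀ᶠ n : ℕ in atTop,
      1000 * (K : ℝ) ^ 2 * (n : ℝ) ^ (2 / 3 : ℝ) ≤ Real.exp (b / 4 * (n : ℝ) ^ (ρ / 4)) := by
    have h := (tendsto_exp_mul_div_rpow_atTop (8 / (3 * ρ)) (b / 4) (by positivity)).comp
      (hpos (ρ / 4) (by positivity))
    filter_upwards [h.eventually_ge_atTop (1000 * (K : ℝ) ^ 2), eventually_gt_atTop 0] with n hn h0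
    have h0' : (0 : ℝ) < n := by positivity
    simp only [Function.comp_apply] at hn
    rw [← Real.rpow_mul h0'.le, show ρ / 4 * (8 / (3 * ρ)) = 2 / 3 by field_simp; norm_num,
      le_div_iff₀ (by positivity)] at hn
    exact hn
  filter_upwards [h1, h2, h3, h4, eventually_gt_atTop 0, hcast.eventually_ge_atTop (2 * η₀ * s),
    (hpos (1 + ρ / 4) (by positivity)).eventually_ge_atTop (2 * η₀),
    (hpos (1 / 6) (by positivity)).eventually_ge_atTop (8000 * (K : ℝ) ^ 3)]
    with n h1 h2 h3 h4 h5 h6 h7 h8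
  exact ⟨h5, h1, h6, h7, h2, h3, h4, h8⟩

end Large

/-! ### The main estimate -/

section Main

variable {n K : ℕ} {σ : Fin n → Fin K}

lemma norm_meanDiff_le (hσ : Balanced σ) {i j : Fin K} (hij : i ≠ j) (hn : 0 < n) :
    ‖meanDiff σ i j‖ ≤ 1.5 * Real.sqrt (K / n) := by
  refine le_of_sq_le_sq ?_ (by positivity)
  rw [norm_sq_meanDiff hσ hij hn, mul_pow, Real.sq_sqrt (by positivity), mul_div_assoc]
  gcongr
  norm_num

/-- The vector `u = symMeanDiff σ i j` is fixed by `S`, hence nearly by `P`. So `⟪P z, u⟫` is nearly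
`⟪z, u⟫ = ‖u‖²`, and Cauchy–Schwarz applies. -/
lemma norm_proj_meanDiff_ge (hσ : Balanced σ) {i j : Fin K} (hij : i ≠ j) (hn : 0 < n)
    {F P : Emb n →L[ℝ] Emb n} {h f : ℝ} (hP : IsTopProjection (offDiag (blockProj σ)) F P h f)
    (hh : 0 < h) (hfh : 2600 * f ≤ h) :
    0.99 * Real.sqrt (K / n) ≤ ‖P (meanDiff σ i j)‖ := by
  have hK := natCast_pos_of_fin i
  have hn' : (0 : ℝ) < n := by positivity
  set z := meanDiff σ i j
  set u := symMeanDiff σ i j with hu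
  set m := Real.sqrt (K / n) with hm
  have hm0 : 0 < m := by positivity
  have hm2 : m ^ 2 = K / n := Real.sq_sqrt (by positivity)
  have hun : ‖u‖ = m := by
    rw [← Real.sqrt_sq (norm_nonneg u), norm_sq_symMeanDiff hσ hij hn]
  have h1 : ‖u - P u‖ ≤ m / 1300 := by
    refine (hP.near u (offDiag_symMeanDiff hσ hn)).trans ?_
    rw [hun, div_mul_eq_mul_div, div_le_iff₀ hh]
    nlinarith
  have h2 : ‖z‖ ≤ 1.5 * m := norm_meanDiff_le hσ hij hn
  have h3 : ⟪P z, u⟫ = m ^ 2 - ⟪z, u - P u⟫ := by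
    rw [hP.symm, inner_sub_right, inner_meanDiff_symMeanDiff hσ hij hn, hm2]; ring
  have h4 := real_inner_le_norm (P z) u
  have h5 := real_inner_le_norm z (u - P u)
  have h6 : ‖z‖ * ‖u - P u‖ ≤ 1.5 * m * (m / 1300) := by gcongr
  rw [hun] at h4
  nlinarith

/-- `P g` differs from its component in the fixed space of `S` by at most `26/2600` of its norm, and
that component is controlled by `K` inner products. The rank of `P` never enters. -/
lemma norm_proj_le (hσ : Balanced σ) (hn : 0 < n)
    {F P : Emb n →L[ℝ] Emb n} {h f : ℝ} (hP : IsTopProjection (offDiag (blockProj σ)) F P h f)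
    (hh : 0 < h) (hF : ∀ v, ‖F v‖ ≤ f * ‖v‖) (hfh : 2600 * f ≤ h) {g : Emb n}
    (hg : ∑ k, ⟪P (blockVec σ k), g⟫ ^ 2 < 9 * (K : ℝ)) :
    0.99 * ‖P g‖ ≤ 3 * Real.sqrt K := by
  have hS := norm_apply_le_of_cube_eq (offDiag_symm (blockProj σ)) (offDiag_blockProj_cube hσ hn)
  have h1 := hP.norm_sub_half_le hh hS hF g
  have h2 := norm_sq_half_le hσ hn (P g)
  set a := (1 / 2 : ℝ) • (offDiag (blockProj σ) (offDiag (blockProj σ) (P g)) +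
    offDiag (blockProj σ) (P g)) with ha
  simp only [← hP.symm] at h2
  have h3 : ‖a‖ ≤ 3 * Real.sqrt K := by
    refine le_of_sq_le_sq ?_ (by positivity)
    rw [mul_pow, Real.sq_sqrt (by positivity)]
    linarith
  have h4 := norm_add_le (P g - a) a
  rw [sub_add_cancel] at h4
  have h5 : 26 * (f / h) * ‖P g‖ ≤ 0.01 * ‖P g‖ := by
    refine mul_le_mul_of_nonneg_right ?_ (norm_nonneg _)
    rw [mul_div_assoc', div_le_iff₀ hh]
    linarith
  linarith

/-- The arithmetic that turns the bound of `le_abs_inner_of_near` into the claimed one. -/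
lemma le_of_margins {B c₀ ε δ ζ : ℝ} (hB : 0 ≤ B) (hc₀ : 0 ≤ c₀) (hε : 2 * ε ≤ 0.01 * B)
    (hεζ : 2 * ε * ζ ≤ 0.01 * B * c₀) (hδ : 0 ≤ δ) (hδ1 : 3 * δ ≤ 0.01)
    (hδζ : 3 * δ * ζ ≤ 0.01 * c₀) :
    B * c₀ ≤ (B - 2 * ε) / (1 + 3 * δ) * (1.08 * c₀ - 3 * δ * ζ) - 2 * ε * ζ := by
  have h1 : 0.98 * B ≤ (B - 2 * ε) / (1 + 3 * δ) := by
    rw [le_div_iff₀ (by positivity)]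
    nlinarith
  have h2 : 0.98 * B * (1.07 * c₀) ≤ (B - 2 * ε) / (1 + 3 * δ) * (1.08 * c₀ - 3 * δ * ζ) := by
    refine mul_le_mul h1 (by linarith) (by positivity) (le_trans (by positivity) h1)
  nlinarith [mul_nonneg hB hc₀]

lemma exp_half_le_one_add {x : ℝ} (h0 : 0 ≤ x) (h1 : x ≤ 1) : Real.exp (x / 2) ≤ 1 + x := by
  have h := Real.abs_exp_sub_one_le (x := x / 2) (by rw [abs_of_nonneg (by linarith)]; linarith)
  rw [abs_of_nonneg (by linarith : 0 ≤ x / 2)] at h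
  linarith [(abs_le.1 h).2]

/-- Number of steps within which the signal grows to the exit radius while the perturbations stay
negligible. -/
lemma exists_horizon {ρ c s b η₀ δ : ℝ} (hL : IsLarge K ρ c s b η₀ δ n) (hK : 0 < K) (hc : 0 < c)
    (hs : 0 < s) {η h f ε a : ℝ} (hη : 0 < η) (hη₀ : η ≤ η₀) (hb : 0 < b) (hbh : b / n ≤ h)
    (hηh : η * h ≤ 1) (hf : f = 2 * (c * (n : ℝ) ^ (-(1 + ρ / 2)))) (hε : 0 < ε) (hδ : 0 < δ)
    (ha : ε / (500 * (K : ℝ) ^ 2 * Real.sqrt n) ≤ a) :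
    ∃ N₀ : ℕ, 1 ≤ N₀ ∧ Real.exp (η * (16 * f) * N₀) ≤ 1 + δ ∧
      N₀ * (η * (4 * (s + c) / (n : ℝ) ^ 2 * (ε * Del n))) ≤ δ * a ∧
      ε * Del n ≤ (1 + η * h) ^ N₀ * (a / 2) := by
  have hn := hL.pos
  have hn' : (0 : ℝ) < n := by positivity
  have hK0 : (0 : ℝ) < K := by positivity
  have hsn : 0 < Real.sqrt n := by positivity
  have hΔeq : Del n = (n : ℝ) ^ (1 / 6 : ℝ) := rfl
  have hΔ0 : 0 < Del n := by rw [hΔeq]; positivity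
  have hf0 : 0 ≤ f := by rw [hf]; positivity
  have hh0 : 0 ≤ h := le_trans (by positivity) hbh
  -- The geometric mean of the scales `n` of `1/h` and `n^(1+ρ/2)` of `1/f`: here `h H` grows like
  -- `n^(ρ/4)` and `f H` decays like `n^(-ρ/4)`.
  set H := (n : ℝ) ^ (1 + ρ / 4) with hH
  have hH0 : 0 < H := by positivity
  set N₀ := ⌊H / η⌋₊ with hN₀
  have hNle : η * N₀ ≤ H := by
    have := Nat.floor_le (by positivity : 0 ≤ H / η)
    rw [le_div_iff₀ hη] at this
    linarith
  have hNge : H / 2 ≤ η * N₀ := by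
    have h1 := Nat.lt_floor_add_one (H / η)
    rw [div_lt_iff₀ hη, add_mul, one_mul, mul_comm _ η] at h1
    have h2 := hL.stepSize_horizon
    linarith
  refine ⟨N₀, ?_, ?_, ?_, ?_⟩
  · rw [Nat.one_le_iff_ne_zero]
    intro h0
    rw [h0, Nat.cast_zero, mul_zero] at hNge
    linarith
  · refine le_trans (Real.exp_le_exp.2 ?_) hL.drift
    calc η * (16 * f) * N₀ = 16 * f * (η * N₀) := by ring
      _ ≤ 16 * f * H := by gcongr
      _ = 32 * c * ((n : ℝ) ^ (-(1 + ρ / 2)) * (n : ℝ) ^ (1 + ρ / 4)) := by rw [hf, hH]; ring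
      _ = _ := by rw [← Real.rpow_add hn']; congr 2; ring
  · refine le_trans ?_ (mul_le_mul_of_nonneg_left ha hδ.le)
    have h1 : H * Del n * Real.sqrt n / (n : ℝ) ^ 2 = (n : ℝ) ^ (ρ / 4 - 1 / 3) := by
      rw [hH, hΔeq, Real.sqrt_eq_rpow, ← Real.rpow_add hn', ← Real.rpow_add hn',
        ← Real.rpow_natCast (n : ℝ) 2, ← Real.rpow_sub hn']
      congr 1
      push_cast
      ring
    have h2 := hL.noise
    rw [← h1] at h2
    calc N₀ * (η * (4 * (s + c) / (n : ℝ) ^ 2 * (ε * Del n)))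
        = (η * N₀) * (4 * (s + c) / (n : ℝ) ^ 2 * (ε * Del n)) := by ring
      _ ≤ H * (4 * (s + c) / (n : ℝ) ^ 2 * (ε * Del n)) := by gcongr
      _ = (2000 * (K : ℝ) ^ 2 * (s + c) * (H * Del n * Real.sqrt n / (n : ℝ) ^ 2)) *
          (ε / (500 * (K : ℝ) ^ 2 * Real.sqrt n)) := by
          field_simp
          ring
      _ ≤ δ * (ε / (500 * (K : ℝ) ^ 2 * Real.sqrt n)) := by gcongr
  · have h1 : Real.exp (b / 4 * (n : ℝ) ^ (ρ / 4)) ≤ (1 + η * h) ^ N₀ := by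
      have h2 := exp_half_le_one_add (mul_nonneg hη.le hh0) hηh
      refine le_trans ?_ (pow_le_pow_left₀ (Real.exp_nonneg _) h2 N₀)
      rw [← Real.exp_nat_mul]
      refine Real.exp_le_exp.2 ?_
      calc b / 4 * (n : ℝ) ^ (ρ / 4) = (b / n) / 2 * (H / 2) := by
            rw [hH, Real.rpow_add hn', Real.rpow_one]; field_simp; norm_num
        _ ≤ h / 2 * (η * N₀) := by gcongr
        _ = _ := by ring
    have h4 : Del n * Real.sqrt n = (n : ℝ) ^ (2 / 3 : ℝ) := by
      rw [hΔeq, Real.sqrt_eq_rpow, ← Real.rpow_add hn']; norm_num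
    have h5 := hL.growth.trans h1
    rw [← h4] at h5
    calc ε * Del n = (1000 * (K : ℝ) ^ 2 * (Del n * Real.sqrt n)) *
          (ε / (500 * (K : ℝ) ^ 2 * Real.sqrt n) / 2) := by
          field_simp
          ring
      _ ≤ _ := by gcongr

/-- In the good event, the projected sample has a large component along every `meanDiff`. -/
lemma goodEvent_bounds (hσ : Balanced σ) (hK : 2 ≤ K) (hn : 0 < n)
    {F P : Emb n →L[ℝ] Emb n} {h f : ℝ} (hP : IsTopProjection (offDiag (blockProj σ)) F P h f)
    (hh : 0 < h) (hF : ∀ v, ‖F v‖ ≤ f * ‖v‖) (hfh : 2600 * f ≤ h) {g : Emb n}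
    (hg : g ∈ goodEvent (fun k => P (blockVec σ k)) (fun i j => P (meanDiff σ i j))) :
    1 / (10 * (K : ℝ) ^ 2) ≤ ‖P g‖ ∧ ‖g‖ ≤ 50 * Real.sqrt n ∧
      ∀ i j : Fin K, i ≠ j →
        1.08 * (1 / (20 * (K : ℝ) ^ 2 * Real.sqrt n)) * ‖P g‖ ≤ |⟪meanDiff σ i j, P g⟫| := by
  obtain ⟨hg1, hg2, hg3⟩ := hg
  have hn' : (0 : ℝ) < n := by positivity
  have hK0 : (0 : ℝ) < K := by positivity
  have hsn : 0 < Real.sqrt n := by positivity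
  have hPg := norm_proj_le hσ hn hP hh hF hfh hg1
  set c₀ := 1 / (20 * (K : ℝ) ^ 2 * Real.sqrt n) with hc₀
  have hc₀0 : 0 < c₀ := by positivity
  have hinner : ∀ i j : Fin K, i ≠ j → 3.3 * Real.sqrt K * c₀ ≤ |⟪meanDiff σ i j, P g⟫| := by
    intro i j hij
    have hlt : ∀ i j : Fin K, i < j → 3.3 * Real.sqrt K * c₀ ≤ |⟪meanDiff σ i j, P g⟫| := by
      intro i j hij
      have := hg2 i j hij
      rw [hP.symm] at this
      refine le_trans (le_of_eq ?_) this
      rw [hc₀]; ring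
    rcases lt_or_gt_of_ne hij with h | h
    · exact hlt i j h
    · have := hlt j i h
      rw [inner_meanDiff hσ] at this ⊢
      rwa [abs_sub_comm]
  refine ⟨?_, ?_, fun i j hij => ?_⟩
  · have hij : (⟨0, by omega⟩ : Fin K) ≠ ⟨1, by omega⟩ := by simp
    have h2 := abs_real_inner_le_norm (meanDiff σ ⟨0, by omega⟩ ⟨1, by omega⟩) (P g)
    have h4 : 3.3 * Real.sqrt K * c₀ ≤ 1.5 * Real.sqrt (K / n) * ‖P g‖ :=
      (hinner _ _ hij).trans (h2.trans
        (mul_le_mul_of_nonneg_right (norm_meanDiff_le hσ hij hn) (norm_nonneg _)))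
    have e : 3.3 * Real.sqrt K * c₀ =
        1.5 * Real.sqrt (K / n) * (1.1 * (1 / (10 * (K : ℝ) ^ 2))) := by
      rw [hc₀, Real.sqrt_div hK0.le]; field_simp; norm_num
    rw [e] at h4
    have h5 := le_of_mul_le_mul_left h4 (by positivity)
    have : 0 < 1 / (10 * (K : ℝ) ^ 2) := by positivity
    linarith
  · refine le_of_sq_le_sq ?_ (by positivity)
    rw [mul_pow, Real.sq_sqrt hn'.le]
    linarith
  · refine le_trans ?_ (hinner i j hij)
    -- The margin `1.08` survives because `3.3 · 0.99 / 3 = 1.089`.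
    rw [mul_right_comm]
    exact mul_le_mul_of_nonneg_right (by linarith [Real.sqrt_nonneg (K : ℝ)]) hc₀0.le

/-- Inside the exit radius, an update is a small perturbation of a fixed linear map. -/
lemma exists_step_eq (hσ : Balanced σ) (hK : 1 ≤ K) (hn : 2 ≤ n) {p q : ℝ} (hp : 0 < p)
    (hq : 0 < q) {L T : ℕ} (hs : 0 < totalWeight L T) {c : ℝ} {C : Matrix (Fin n) (Fin n) ℝ}
    (hR : n * specNorm (C - expCooc σ p q L T) ≤ c) (η : ℝ) {B : ℝ}
    (hB : B ^ 2 = 1 / n) (w : Emb n) (hw : ‖w‖ ≤ B) :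
    ∃ r : Emb n, step C η w = w + η • ((signalWeight K L T p q / n) • offDiag (blockProj σ) w +
      offDiag ((C - expCooc σ p q L T) * (1 - avgMat n)) w + r) ∧
      ‖r‖ ≤ 4 * (totalWeight L T + c) / (n : ℝ) ^ 2 * B := by
  have hn0 : 0 < n := by omega
  have hn' : (0 : ℝ) < n := by positivity
  have hn2 : (2 : ℝ) ≤ n := by exact_mod_cast hn
  refine ⟨offDiag (-(degMat C * (softmax w - avgMat n))) w, ?_, ?_⟩
  · rw [step_eq, neg_gradMat_eq hσ hK hn0 hp hq L T, offDiag_add, offDiag_add, offDiag_smul]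
  have hsq : ‖w‖ ^ 2 ≤ 1 / n := by
    rw [← hB]; exact pow_le_pow_left₀ (norm_nonneg _) hw 2
  refine (norm_remainder_le hσ hK hn0 hp hq hs.le C w ?_).trans ?_
  · refine (mul_le_mul_of_nonneg_left hsq zero_le_two).trans ?_
    rw [mul_one_div]
    exact (div_le_one hn').2 hn2
  · have hν0 := specNorm_nonneg (C - expCooc σ p q L T)
    have hc0 : 0 ≤ c := le_trans (by positivity) hR
    calc _ ≤ 4 * (totalWeight L T + c) / n * (1 / n) * B := by gcongr
      _ = _ := by field_simp

lemma eps_mul_Del_sq (hn : 0 < n) : (eps n * Del n) ^ 2 = 1 / n := by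
  have hn' : (0 : ℝ) < n := by positivity
  rw [eps, Del, one_div, ← Real.rpow_neg hn'.le, ← Real.rpow_add hn', ← Real.rpow_natCast,
    ← Real.rpow_mul hn'.le,
    show ((-(2 / 3) + 1 / 6) * ((2 : ℕ) : ℝ) : ℝ) = -1 by norm_num, Real.rpow_neg_one, one_div]

/-- Every initialization in the good event leads to separated communities. -/
lemma exists_returns_of_goodEvent {L T : ℕ} (hK : 2 ≤ K) {ρ c b η₀ δ : ℝ} (hρ : 0 < ρ)
    (hc : 0 < c) (hb : 0 < b) (hs : 0 < totalWeight L T) (hδ : δ = 1 / (12000 * (K : ℝ) ^ 3))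
    (hL : IsLarge K ρ c (totalWeight L T) b η₀ δ n) (hσ : Balanced σ) {p q : ℝ} (hp : 0 < p)
    (hq : 0 < q) {C : Matrix (Fin n) (Fin n) ℝ}
    (hR : specNorm (C - expCooc σ p q L T) ≤ c * (n : ℝ) ^ (-(1 + ρ / 2)))
    {f : ℝ} (hf : f = 2 * (c * (n : ℝ) ^ (-(1 + ρ / 2))))
    (hb1 : b ≤ signalWeight K L T p q) (hb2 : signalWeight K L T p q ≤ totalWeight L T)
    {P : Emb n →L[ℝ] Emb n} (hP : IsTopProjection (offDiag (blockProj σ))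
      (offDiag ((C - expCooc σ p q L T) * (1 - avgMat n))) P (signalWeight K L T p q / n) f)
    (hF : ∀ v, ‖offDiag ((C - expCooc σ p q L T) * (1 - avgMat n)) v‖ ≤ f * ‖v‖)
    (hfh : 2600 * f ≤ signalWeight K L T p q / n) {η : ℝ} (hη : 0 < η) (hη₀ : η ≤ η₀) {g : Emb n}
    (hg : g ∈ goodEvent (fun k => P (blockVec σ k)) (fun i j => P (meanDiff σ i j))) :
    ∃ w, Returns C η g w ∧ ∀ i j : Fin K, i ≠ j →
      eps n * Del n / (20 * (K : ℝ) ^ 2 * Real.sqrt n) ≤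
        |clusterMean σ w i - clusterMean σ w j| := by
  have hn := hL.pos
  have hn' : (0 : ℝ) < n := by positivity
  have hn1 : (1 : ℝ) ≤ n := by exact_mod_cast hn
  have hK' : (2 : ℝ) ≤ K := by exact_mod_cast hK
  have hK0 : (0 : ℝ) < K := by linarith
  have hh0 : 0 < signalWeight K L T p q / n := div_pos (by linarith) hn'
  have hbh : b / n ≤ signalWeight K L T p q / n := by gcongr
  have hhs : signalWeight K L T p q / n ≤ totalWeight L T / n := by gcongr
  obtain ⟨hPg_lower, hg_upper, hinner⟩ := goodEvent_bounds hσ hK hn hP hh0 hF hfh hg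
  have hf0 : 0 ≤ f := by rw [hf]; positivity
  have hnν : n * specNorm (C - expCooc σ p q L T) ≤ c := by
    refine (mul_le_mul_of_nonneg_left hR hn'.le).trans ?_
    rw [show n * (c * (n : ℝ) ^ (-(1 + ρ / 2))) = c * (n ^ (1 : ℝ) * n ^ (-(1 + ρ / 2))) by
      rw [Real.rpow_one]; ring, ← Real.rpow_add hn']
    exact mul_le_of_le_one_right hc.le (Real.rpow_le_one_of_one_le_of_nonpos hn1 (by linarith))
  have hδ0 : 0 < δ := by rw [hδ]; positivity
  have hK3 : (8 : ℝ) ≤ (K : ℝ) ^ 3 := by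
    have := pow_le_pow_left₀ (by norm_num) hK' 3
    linarith
  have hδ1 : 3 * δ ≤ 0.01 := by
    rw [hδ, mul_one_div, div_le_iff₀ (by positivity)]
    linarith
  have hε0 : 0 < eps n := by rw [eps]; positivity
  have hΔ1 : 8000 * (K : ℝ) ^ 3 ≤ Del n := hL.radius
  -- For `n = 1` one has `Δ = 1`, against the radius condition.
  have hn2 : 2 ≤ n := by
    by_contra! hlt
    have h3 : Del n = 1 := by rw [show n = 1 by omega, Del]; simp
    linarith
  have hBsq := eps_mul_Del_sq hn
  have hεB : eps n ≤ eps n * Del n := le_mul_of_one_le_right hε0.le (by linarith)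
  have hB0 : 0 < eps n * Del n := hε0.trans_le hεB
  have hε2 : 2 * eps n ≤ 0.01 * (eps n * Del n) := by
    have := mul_le_mul_of_nonneg_left (show (200 : ℝ) ≤ Del n by linarith) hε0.le
    linarith
  have hsn : 0 < Real.sqrt n := by positivity
  have hPg0 : 0 < ‖P g‖ := lt_of_lt_of_le (by positivity) hPg_lower
  have hg0 : 0 < ‖g‖ := hPg0.trans_le (hP.norm_apply_le g)
  have hw0 : iter C η g 0 = (eps n / ‖g‖) • g := by simp [iter]
  have hw0n : ‖iter C η g 0‖ = eps n := by
    rw [hw0, norm_smul, Real.norm_of_nonneg (by positivity), div_mul_cancel₀ _ hg0.ne']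
  have hPw0n : ‖P (iter C η g 0)‖ = eps n / ‖g‖ * ‖P g‖ := by
    rw [hw0, map_smul, norm_smul, Real.norm_of_nonneg (by positivity)]
  have hPw0_lower : eps n / (500 * (K : ℝ) ^ 2 * Real.sqrt n) ≤ ‖P (iter C η g 0)‖ := by
    rw [hPw0n]
    calc _ = eps n / (50 * Real.sqrt n) * (1 / (10 * (K : ℝ) ^ 2)) := by
          rw [div_mul_div_comm]; ring
      _ ≤ _ := by gcongr
  have hηh : η * (2 * (signalWeight K L T p q / n)) ≤ 1 := by
    calc _ ≤ η₀ * (2 * (totalWeight L T / n)) := by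
          have : 0 ≤ η₀ := by linarith
          gcongr
      _ = 2 * η₀ * totalWeight L T / n := by ring
      _ ≤ 1 := (div_le_one hn').2 hL.stepSize
  obtain ⟨N₀, hN1, hexp, hnoise, hgrow⟩ := exists_horizon hL (by omega) hc hs hη hη₀ hb hbh
    (by linarith [mul_nonneg hη.le hh0.le]) hf hε0 hδ0 hPw0_lower
  obtain ⟨t, ht1, htB, htmin, hbulk, htop⟩ := hP.exists_exit hη.le hh0.le hηh hf0
    (by positivity) hδ0.le (by linarith) (w := iter C η g)
    (fun t ht => by
      rw [iter, Function.iterate_succ_apply']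
      exact exists_step_eq hσ (by omega) hn2 hp hq hs hnν η hBsq _ ht)
    (by rw [hw0n]; exact hεB) hN1 hexp hnoise hgrow
  refine ⟨iter C η g t, ⟨t, ht1, htB, htmin, rfl⟩, fun i j hij => ?_⟩
  rw [← inner_meanDiff hσ, ← mul_one_div]
  have hz0 := hinner i j hij
  set c₀ := 1 / (20 * (K : ℝ) ^ 2 * Real.sqrt n) with hc₀
  have hc₀0 : 0 < c₀ := by positivity
  -- Measuring `‖z‖` in units of `c₀` explains two constants: `3δ · 40K³ = 0.01` for `δ`, and `2 ·
  -- 40K³ = 0.01 · 8000K³` for the lower bound on `Δ`.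
  have hzn : ‖meanDiff σ i j‖ ≤ 40 * (K : ℝ) ^ 3 * c₀ := by
    refine (norm_meanDiff_le hσ hij hn).trans ?_
    have h1 : Real.sqrt K ≤ K := by
      rw [Real.sqrt_le_left hK0.le, sq]
      exact le_mul_of_one_le_left hK0.le (by linarith)
    rw [Real.sqrt_div hK0.le, hc₀]
    calc 1.5 * (Real.sqrt K / Real.sqrt n) ≤ 2 * (K / Real.sqrt n) := by gcongr; norm_num
      _ = _ := by field_simp; norm_num
  have hδz : 3 * δ * ‖meanDiff σ i j‖ ≤ 0.01 * c₀ := by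
    calc _ ≤ 3 * δ * (40 * (K : ℝ) ^ 3 * c₀) := by gcongr
      _ = _ := by rw [hδ]; field_simp; norm_num
  have hεz : 2 * eps n * ‖meanDiff σ i j‖ ≤ 0.01 * (eps n * Del n) * c₀ := by
    calc _ ≤ 2 * eps n * (40 * (K : ℝ) ^ 3 * c₀) := by gcongr
      _ = 0.01 * (eps n * (8000 * (K : ℝ) ^ 3)) * c₀ := by ring
      _ ≤ _ := by gcongr
  rw [hw0n] at hbulk
  have hz1 : 1.08 * c₀ * ‖P (iter C η g 0)‖ ≤ |⟪meanDiff σ i j, P (iter C η g 0)⟫| := by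
    rw [hPw0n, hw0, map_smul, inner_smul_right, abs_mul,
      abs_of_pos (by positivity : 0 < eps n / ‖g‖), mul_left_comm]
    exact mul_le_mul_of_nonneg_left hz0 (by positivity)
  exact (le_of_margins hB0.le hc₀0.le hε2 hεz hδ0.le hδ1 hδz).trans
    (le_abs_inner_of_near (by positivity) hbulk htop htB hδ0.le hz1 (by linarith))

end Main

end DeepWalk

end

/-! ### Choice of constants and conclusion. -/

theorem theorem3p6 (K L T : ℕ) (hK : 2 ≤ K) (hT : 1 ≤ T) (hTL : T < L)
    (ρ c κ η₀ : ℝ) (hρ : 0 < ρ) (hρ' : ρ < 1) (hc : 0 < c) (hκ : 0 < κ) (hη₀ : 0 < η₀) :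
    ∃ N : ℕ, ∀ n : ℕ, N ≤ n →
      ∀ σ : Fin n → Fin K, DeepWalk.Balanced σ →
      ∀ p q : ℝ, 0 < q → q < p → p ≤ 1 → κ * p ≤ p - q →
      ∀ (Ω : Type*) [MeasurableSpace Ω] (μ : MeasureTheory.Measure Ω)
        [MeasureTheory.IsProbabilityMeasure μ] (G : Ω → SimpleGraph (Fin n)),
        DeepWalk.IsSBM σ p q μ G →
      ∀ (ω : Ω) (C : Matrix (Fin n) (Fin n) ℝ),
        DeepWalk.CoocAssumption σ p q L T ρ c (G ω) C →
      ∀ η : ℝ, 0 < η → η ≤ η₀ →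
        ENNReal.ofReal 0.9 ≤ DeepWalk.initLaw n
          {g | ∃ w, DeepWalk.Returns C η g w ∧
            ∀ i j : Fin K, i ≠ j →
              DeepWalk.eps n * DeepWalk.Del n / (20 * (K : ℝ) ^ 2 * Real.sqrt n) ≤
                |DeepWalk.clusterMean σ w i - DeepWalk.clusterMean σ w j|} := by
  open DeepWalk in
  have hK0 : (0 : ℝ) < K := by positivity
  -- A lower bound for `n h` from the parameters alone, so that `N` can be fixed before `σ`, `p`,
  -- `q` and `η`.
  set b : ℝ := 2 * (κ / K) with hb
  have hb0 : 0 < b := by positivity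
  set δ : ℝ := 1 / (12000 * (K : ℝ) ^ 3) with hδ
  obtain ⟨N, hN⟩ := Filter.eventually_atTop.1
    (eventually_isLarge K (c := c) (s := totalWeight L T) (b := b) (η₀ := η₀) (δ := δ) hρ hρ' hb0
      (by positivity))
  refine ⟨N, fun n hn σ hσ p q hq hqp _ hκp Ω _ μ _ G _ ω C hC η hη hηη₀ => ?_⟩
  have hL := hN n hn
  have hn0 := hL.pos
  have hn' : (0 : ℝ) < n := by positivity
  have hp : 0 < p := hq.trans hqp
  obtain ⟨hb1, hb2⟩ := signalWeight_mem (K := K) (by omega) hT hTL hq hqp hκp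
  have hh0 : 0 < signalWeight K L T p q / n := div_pos (by linarith) hn'
  have hR : specNorm (C - expCooc σ p q L T) ≤ c * (n : ℝ) ^ (-(1 + ρ / 2)) := by
    refine hC.norm_lt.le.trans (le_of_eq ?_)
    rw [Real.sqrt_eq_rpow, ← Real.rpow_mul hn'.le, Real.rpow_neg hn'.le, div_eq_mul_inv]
    congr 3
    ring
  set f := 2 * (c * (n : ℝ) ^ (-(1 + ρ / 2))) with hf
  have hf0 : 0 ≤ f := by positivity
  have hfh : 2600 * f ≤ signalWeight K L T p q / n := by
    rw [hf, neg_add, Real.rpow_add hn', Real.rpow_neg_one, le_div_iff₀ hn']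
    calc _ = 5200 * c * (n : ℝ) ^ (-(ρ / 2)) := by field_simp; norm_num
      _ ≤ _ := hL.gap.trans hb1
  have hF : ∀ v, ‖offDiag ((C - expCooc σ p q L T) * (1 - avgMat n)) v‖ ≤ f * ‖v‖ := fun v =>
    (norm_offDiag_le _ v).trans (mul_le_mul_of_nonneg_right
      ((specNorm_mul_one_sub_avgMat_le hn0 _).trans
        (mul_le_mul_of_nonneg_left hR zero_le_two)) (norm_nonneg v))
  obtain ⟨P, hP⟩ := exists_isTopProjection (offDiag_symm (blockProj σ)) (offDiag_symm _)
    (offDiag_blockProj_cube hσ hn0) hh0 hF hf0 (by linarith)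
  -- The success event contains the good event, and monotonicity of the outer measure needs no
  -- measurability of the former.
  refine (measure_goodEvent (by omega) hn0 (fun k => P (blockVec σ k))
    (fun i j => P (meanDiff σ i j))
    (fun k => (hP.norm_apply_le _).trans (norm_blockVec hσ k hn0).le)
    (fun i j hij => norm_proj_meanDiff_ge hσ hij.ne hn0 hP hh0 hfh)).trans
    (MeasureTheory.measure_mono fun g hg => ?_)
  exact exists_returns_of_goodEvent hK hρ hc hb0 (totalWeight_pos hT hTL) hδ hL hσ hp hq
    hR hf hb1 hb2 hP hF hfh hη hηη₀ hg
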